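/- **Theorem (Existence and uniqueness of a solution on the network).** Let $(\mathcal V,\mathcal A)$ be a finite acyclic network: a connected directed graph with finite node set $\mathcal V\subset\mathbb N_{\ge1}$, links $\mathcal A\subseteq\mathcal V\times\mathcal V$ and no directed cycle. For $v\in\mathcal V$ let $\mathcal A_{\rm in}(v)$ and $\mathcal A_{\rm out}(v)$ be the sets of links that end, respectively originate, in $v$. Let $T>0$, $p\in[1,\infty)$, $b,d\in[0,1]$, and for every $a\in\mathcal A$ let $\lambda_a\in C^1([0,T]\times\mathbb R;\mathbb R_{>0})$ and $\rho_{a,0}\in L^\infty((0,1);\mathbb R_{\ge0})$. For $v\in\mathcal V$ and $a\in\mathcal A_{\rm out}(v)$ let the splits $\theta^v_a$ and the sources $s^v_a$ be elements of $L^\infty((0,T);\mathbb R_{\ge0})$ such that, for every $v$ with $\mathcal A_{\rm out}(v)\neq\emptyset$, $\sum_{\tilde a\in\mathcal A_{\rm out}(v)}\theta^v_{\tilde a}(t)=1$ for a.e. $t\in(0,T)$. A *weak solution on the network* consists of densities $\rho_a\in C([0,T];L^p((0,1)))\cap L^\infty((0,T);L^\infty((0,1)))$, inflows $u_a\in L^1((0,T))$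 and outflows $y_a\in L^1((0,T))$, $a\in\mathcal A$, such that 1. for every $a\in\mathcal A$, with $W_a(t):=\int_b^d\rho_a(t,z)\,dz$, the problem $$\partial_t\rho_a+\partial_x\big(\lambda_a(t,W_a(t))\,\rho_a\big)=0,\quad \rho_a(0,\cdot)=\rho_{a,0},\quad \lambda_a(t,W_a(t))\rho_a(t,0)=u_a(t),\quad \lambda_a(t,W_a(t))\rho_a(t,1)=y_a(t)$$ holds on $(0,T)\times(0,1)$ in the weak sense, that is, for every $\varphi\in C^1(\mathbb R^2)$ with $\varphi(T,\cdot)=0$ on $[0,1]$, $$\int_0^T\!\!\int_0^1\rho_a\big(\partial_t\varphi+\lambda_a(t,W_a(t))\,\partial_x\varphi\big)\,dx\,dt+\int_0^1\rho_{a,0}(x)\varphi(0,x)\,dx+\int_0^Tu_a(t)\varphi(t,0)\,dt-\int_0^Ty_a(t)\varphi(t,1)\,dt=0;$$ 2. flow is conserved at the nodes: for all $v\in\mathcal V$ and $a\in\mathcal A_{\rm out}(v)$, $$u_a(t)=s^v_a(t)+\theta^v_a(t)\sum_{\tilde a\in\mathcal A_{\rm in}(v)}y_{\tilde a}(t)\qquad\text{for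 a.e. }t\in(0,T).$$ Then there is a weak solution on the network with $\rho_a,u_a,y_a\ge0$ almost everywhere for all $a\in\mathcal A$, and it is unique among all weak solutions on the network (of whatever sign): any other one has the same $\rho_a(t,\cdot)$ in $L^p((0,1))$ for all $t\in[0,T]$, and the same $u_a$ and $y_a$ a.e. on $(0,T)$, for all $a\in\mathcal A$. -/

import Mathlib

open MeasureTheory Set
open scoped ENNReal

/-- A (finite) network: a connected directed graph whose nodes are positive integers and whose
links are ordered pairs of nodes.  The link `(v, w)` originates in `v` and ends in `w`;
connectedness means that any two nodes are joined by an undirected path. -/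
structure Network where
  nodes : Finset ℕ
  one_le_of_mem : ∀ v ∈ nodes, 1 ≤ v
  links : Finset (ℕ × ℕ)
  links_subset : links ⊆ nodes ×ˢ nodes
  connected : ∀ v ∈ nodes, ∀ w ∈ nodes, Relation.EqvGen (fun i j => (i, j) ∈ links) v w

namespace Network

/-- The links of the network, as a (finite) type. -/
abbrev Link (N : Network) : Type := {a : ℕ × ℕ // a ∈ N.links}

/-- The node in which a link originates. -/
def origin {N : Network} (a : N.Link) : ℕ := a.1.1

/-- The node in which a link ends. -/
def target {N : Network} (a : N.Link) : ℕ := a.1.2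

/-- The links ending in `v`. -/
def inLinks (N : Network) (v : ℕ) : Finset N.Link := Finset.univ.filter fun a => target a = v

/-- The links originating in `v`. -/
def outLinks (N : Network) (v : ℕ) : Finset N.Link := Finset.univ.filter fun a => origin a = v

/-- There is no directed cycle. -/
def Acyclic (N : Network) : Prop :=
  ∀ v, ¬ Relation.TransGen (fun i j => (i, j) ∈ N.links) v v

end Network

/-- `f ∈ L^∞(I; ℝ_{≥0})`. -/
def IsLinftyNonneg (I : Set ℝ) (f : ℝ → ℝ) : Prop :=
  MemLp f ∞ (volume.restrict I) ∧ ∀ᵐ x ∂volume.restrict I, 0 ≤ f x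

/-- The set `Θ` of splits.  A link `a` belongs to `outLinks v` for exactly one `v`, its origin, so
the split `θ_a^v` is indexed by the link alone.  The splits sum to one at every node from which at
least one link originates. -/
def IsSplit (N : Network) (T : ℝ) (θ : N.Link → ℝ → ℝ) : Prop :=
  (∀ a, IsLinftyNonneg (Ioo 0 T) (θ a)) ∧
  ∀ v ∈ N.nodes, (N.outLinks v).Nonempty →
    ∀ᵐ t ∂volume.restrict (Ioo 0 T), ∑ a ∈ N.outLinks v, θ a t = 1

/-- The set `S` of sources; `s_a^v` is indexed by the link `a` alone, as for the splits. -/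
def IsSource (N : Network) (T : ℝ) (s : N.Link → ℝ → ℝ) : Prop :=
  ∀ a, IsLinftyNonneg (Ioo 0 T) (s a)

/-- `lam ∈ C¹([0,T] × ℝ; ℝ_{>0})`. -/
def IsVelocity (T : ℝ) (lam : ℝ → ℝ → ℝ) : Prop :=
  ContDiffOn ℝ 1 (Function.uncurry lam) (Icc 0 T ×ˢ univ) ∧ ∀ t ∈ Icc 0 T, ∀ w, 0 < lam t w

/-- The space `L^p((0,1))`. -/
noncomputable abbrev LpUnit (p : ℝ≥0∞) := Lp ℝ p (volume.restrict (Ioo (0 : ℝ) 1))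

/-- `ρ ∈ C([0,T]; L^p((0,1))) ∩ L^∞((0,T); L^∞((0,1)))`. -/
def InSolutionSpace (T : ℝ) (p : ℝ≥0∞) [Fact (1 ≤ p)] (ρ : ℝ → LpUnit p) : Prop :=
  ContinuousOn ρ (Icc 0 T) ∧
  ∃ M : ℝ, ∀ᵐ t ∂volume.restrict (Ioo 0 T),
    ∀ᵐ x ∂volume.restrict (Ioo (0 : ℝ) 1), |ρ t x| ≤ M

/-- `ρ` is a weak solution, on one link, of
`∂_t ρ + ∂_x (lam(t, ∫_b^d ρ(t,y) dy) ρ) = 0` on `(0,T) × (0,1)` with initial datum `ρ₀`,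
flow `u` through `x = 0` and flow `y` through `x = 1`: the equation is multiplied by a test
function that vanishes at `t = T`, and integrated by parts.
(For `ρ ∈ C([0,T]; L^p)`, `lam` continuous and `ρ₀, u, y` integrable, all integrals exist.) -/
def IsLinkWeakSolution (T : ℝ) {p : ℝ≥0∞} (b d : ℝ) (lam : ℝ → ℝ → ℝ) (ρ₀ u y : ℝ → ℝ)
    (ρ : ℝ → LpUnit p) : Prop :=
  ∀ φ : ℝ → ℝ → ℝ, ContDiff ℝ 1 (Function.uncurry φ) → (∀ x ∈ Icc (0 : ℝ) 1, φ T x = 0) →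
    (∫ t in Ioo 0 T, ∫ x in Ioo (0 : ℝ) 1,
        ρ t x * (deriv (fun τ => φ τ x) t +
          lam t (∫ z in b..d, ρ t z) * deriv (fun ξ => φ t ξ) x))
      + (∫ x in Ioo (0 : ℝ) 1, ρ₀ x * φ 0 x)
      + (∫ t in Ioo 0 T, u t * φ t 0)
      - (∫ t in Ioo 0 T, y t * φ t 1) = 0

/-- Weak solutions of the model on the whole network: densities `ρ a`, inflows `u a` and
outflows `y a` such that, on every link, `ρ a` is a weak solution with these boundary flows, in the
class `C([0,T]; L^p) ∩ L^∞`, and such that flow is conserved at the nodes. -/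
structure IsNetworkWeakSolution (N : Network) (T : ℝ) (p : ℝ≥0∞) [Fact (1 ≤ p)] (b d : ℝ)
    (lam : N.Link → ℝ → ℝ → ℝ) (ρ₀ θ s : N.Link → ℝ → ℝ)
    (ρ : N.Link → ℝ → LpUnit p) (u y : N.Link → ℝ → ℝ) : Prop where
  mem_space : ∀ a, InSolutionSpace T p (ρ a)
  inflow_integrable : ∀ a, IntegrableOn (u a) (Ioo 0 T)
  outflow_integrable : ∀ a, IntegrableOn (y a) (Ioo 0 T)
  weak : ∀ a, IsLinkWeakSolution T b d (lam a) (ρ₀ a) (u a) (y a) (ρ a)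
  node : ∀ v ∈ N.nodes, ∀ a ∈ N.outLinks v, ∀ᵐ t ∂volume.restrict (Ioo 0 T),
    s a t + θ a t * ∑ a' ∈ N.inLinks v, y a' t = u a t

/-!
Along a single link the density is carried by the characteristics `x = z + ξ t`, where `ξ' = c` is
the speed, so for a given `c` the solution is the translate `ρ t x = g (x - ξ t)` of one profile
`g`, which records the initial datum on `(0, 1)` and the inflow, divided by the speed at the time
of entry, on the negative half-line. Weak solutions of this linear problem are unique because every
function of `x - ξ t` can be used for testing.

The nonlocal mass `∫_b^d ρ` is then a difference of primitives of the data, hence Lipschitz in `ξ`,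
and the requirement `c t = lam t (∫_b^d ρ t)` becomes a fixed-point equation for the mass as a
function of time. It is a contraction for a norm with exponential weight in time, which yields a
unique self-consistent speed on all of `[0, T]` at once.

Without directed cycles the links can be treated in the direction of the flow, by well-founded
recursion: the inflow of a link is determined by the outflows of the links ending at its origin.
-/

section BoundedDatum

/-- An everywhere defined, measurable representative of a function in `L^∞(I)`: it is bounded by
`K` at every point and extended by zero outside `I`. -/
structure IsBoundedDatum (I : Set ℝ) (K : ℝ) (f : ℝ → ℝ) : Prop where
  measurable : Measurable f
  abs_le : ∀ x, |f x| ≤ K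
  eq_zero : ∀ x, x ∉ I → f x = 0

variable {I : Set ℝ} {K a b : ℝ} {f : ℝ → ℝ}

namespace IsBoundedDatum

theorem bound_nonneg (hf : IsBoundedDatum I K f) : 0 ≤ K := (abs_nonneg _).trans (hf.abs_le 0)

theorem support_subset (hf : IsBoundedDatum I K f) : Function.support f ⊆ I :=
  Function.support_subset_iff'.2 hf.eq_zero

theorem integrable (hf : IsBoundedDatum (Ioo a b) K f) : Integrable f := by
  rw [← integrableOn_iff_integrable_of_support_subset hf.support_subset]
  exact Measure.integrableOn_of_bounded (M := K) (by simp) hf.measurable.aestronglyMeasurable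
    (Filter.Eventually.of_forall hf.abs_le)

theorem integrable_mul (hf : IsBoundedDatum (Ioo a b) K f) {k : ℝ → ℝ} (hk : Continuous k) :
    Integrable fun x => f x * k x := by
  have hsupp : Function.support (fun x => f x * k x) ⊆ Icc a b :=
    (Function.support_mul_subset_left _ _).trans
      (hf.support_subset.trans Ioo_subset_Icc_self)
  rw [← integrableOn_iff_integrable_of_support_subset hsupp]
  exact hf.integrable.integrableOn.mul_continuousOn hk.continuousOn isCompact_Icc

theorem memLp (hf : IsBoundedDatum (Ioo a b) K f) (p : ℝ≥0∞) : MemLp f p := by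
  have hmem : MemLp f p (volume.restrict (Ioo a b)) :=
    MemLp.of_bound hf.measurable.aestronglyMeasurable K (Filter.Eventually.of_forall hf.abs_le)
  rwa [← memLp_indicator_iff_restrict measurableSet_Ioo,
    indicator_eq_self.2 hf.support_subset] at hmem

theorem indicator_comp (hf : IsBoundedDatum I K f) {k : ℝ → ℝ} (hk : Measurable k) {J : Set ℝ}
    (hJ : MeasurableSet J) : IsBoundedDatum J K (J.indicator fun t => f (k t)) := by
  refine ⟨(hf.measurable.comp hk).indicator hJ, fun t => ?_, fun t ht => indicator_of_notMem ht _⟩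
  by_cases ht : t ∈ J
  · simpa [ht] using hf.abs_le (k t)
  · simpa [ht] using hf.bound_nonneg

theorem setIntegral (hf : IsBoundedDatum I K f) {g : ℝ → ℝ} :
    ∫ x in I, f x * g x = ∫ x, f x * g x :=
  setIntegral_eq_integral_of_forall_compl_eq_zero fun x hx => by rw [hf.eq_zero x hx, zero_mul]

end IsBoundedDatum

theorem abs_intervalIntegral_sub_le (hf : Integrable f) (x₁ x₂ : ℝ) :
    |(∫ x in (0 : ℝ)..x₂, f x) - ∫ x in (0 : ℝ)..x₁, f x| ≤ ∫ x, |f x| := by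
  rw [intervalIntegral.integral_interval_sub_left hf.intervalIntegrable hf.intervalIntegrable]
  exact intervalIntegral.norm_integral_le_integral_norm_uIoc.trans
    (setIntegral_le_integral hf.norm (Filter.Eventually.of_forall fun _ => norm_nonneg _))

theorem exists_ae_abs_le_of_memLp_top {α : Type*} [MeasurableSpace α] {μ : Measure α}
    {f : α → ℝ} (hf : MemLp f ∞ μ) :
    ∃ K : ℝ, ∀ᵐ x ∂μ, |f x| ≤ K := by
  have hfin : eLpNormEssSup f μ ≠ ∞ := by
    simpa only [eLpNorm_exponent_top] using hf.2.ne
  refine ⟨(eLpNormEssSup f μ).toReal, ?_⟩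
  filter_upwards [ae_le_eLpNormEssSup (f := f) (μ := μ)] with x hx
  simpa using (ENNReal.toReal_le_toReal (by simp) hfin).2 hx

theorem exists_isBoundedDatum (hI : MeasurableSet I) (hf : MemLp f ∞ (volume.restrict I)) :
    ∃ K g, IsBoundedDatum I K g ∧ g =ᵐ[volume.restrict I] f ∧
      ((∀ᵐ x ∂volume.restrict I, 0 ≤ f x) → ∀ x, 0 ≤ g x) := by
  obtain ⟨K, hK⟩ := exists_ae_abs_le_of_memLp_top hf
  have hmk : Measurable (hf.1.mk f) := hf.1.stronglyMeasurable_mk.measurable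
  -- The lower cut-off is `0` for data that are nonnegative almost everywhere.
  obtain ⟨L, hL, hfL, hsign⟩ : ∃ L ≤ (0 : ℝ), (∀ᵐ x ∂volume.restrict I, L ≤ f x) ∧
      ((∀ᵐ x ∂volume.restrict I, 0 ≤ f x) → L = 0) := by
    by_cases hpos : ∀ᵐ x ∂volume.restrict I, 0 ≤ f x
    · exact ⟨0, le_rfl, hpos, fun _ => rfl⟩
    · exact ⟨-|K|, neg_nonpos.2 (abs_nonneg K),
        hK.mono fun x hx => (abs_le.1 (hx.trans (le_abs_self K))).1, fun h => absurd h hpos⟩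
  let g := I.indicator fun x => max L (min |K| (hf.1.mk f x))
  have hle : ∀ x, L ≤ g x ∧ g x ≤ |K| := fun x => by
    by_cases hx : x ∈ I
    · simp [g, hx, hL.trans (abs_nonneg K)]
    · simp [g, hx, hL]
  refine ⟨max |K| (-L), g, ⟨(measurable_const.max (measurable_const.min hmk)).indicator hI,
    fun x => abs_le.2 ⟨?_, ?_⟩, fun x hx => indicator_of_notMem hx _⟩, ?_, ?_⟩
  · linarith [(hle x).1, le_max_right |K| (-L)]
  · exact (hle x).2.trans (le_max_left _ _)
  · filter_upwards [hK, hfL, hf.1.ae_eq_mk, ae_restrict_mem hI] with x hxK hxL hxmk hx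
    simp only [g, indicator_of_mem hx]
    rw [← hxmk, min_eq_right ((abs_le.1 (hxK.trans (le_abs_self K))).2), max_eq_right hxL]
  · intro hpos x
    rw [← hsign hpos]
    exact (hle x).1

end BoundedDatum

section Flow

/-- `ξ` is the primitive, vanishing at zero, of a continuous speed `c ≥ m > 0`. It is encoded as an
order isomorphism, so that `ξ.symm r` is the time at which the travelled distance is `r`; the
characteristic curves are the translates `t ↦ z + ξ t`. -/
structure IsFlow (m : ℝ) (c : ℝ → ℝ) (ξ : ℝ ≃o ℝ) : Prop where
  speed_continuous : Continuous c
  lower_pos : 0 < m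
  le_speed : ∀ t, m ≤ c t
  hasDerivAt : ∀ t, HasDerivAt ξ (c t) t
  map_zero : ξ 0 = 0

theorem mul_sub_le_of_le_hasDerivAt {m : ℝ} {f f' : ℝ → ℝ} (hf : ∀ t, HasDerivAt f (f' t) t)
    (hm : ∀ t, m ≤ f' t) {s t : ℝ} (hst : s ≤ t) : m * (t - s) ≤ f t - f s :=
  mul_sub_le_image_sub_of_le_deriv (fun t => (hf t).differentiableAt)
    (fun t => (hm t).trans_eq (hf t).deriv.symm) hst

theorem exists_isFlow {m : ℝ} {c : ℝ → ℝ} (hc : Continuous c) (hm : 0 < m)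
    (hmc : ∀ t, m ≤ c t) : ∃ ξ, IsFlow m c ξ := by
  let F : ℝ → ℝ := fun t => ∫ s in (0 : ℝ)..t, c s
  have hF : ∀ t, HasDerivAt F (c t) t := fun t => hc.integral_hasStrictDerivAt 0 t |>.hasDerivAt
  have hF0 : F 0 = 0 := intervalIntegral.integral_same
  have hmono : StrictMono F := strictMono_of_deriv_pos fun t => by
    rw [(hF t).deriv]; exact hm.trans_le (hmc t)
  have htop : Filter.Tendsto F Filter.atTop Filter.atTop := by
    refine Filter.tendsto_atTop_mono' _ ?_ (Filter.tendsto_id.const_mul_atTop hm)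
    filter_upwards [Filter.eventually_ge_atTop 0] with t ht
    simpa [hF0] using mul_sub_le_of_le_hasDerivAt hF hmc ht
  have hbot : Filter.Tendsto F Filter.atBot Filter.atBot := by
    refine Filter.tendsto_atBot_mono' _ ?_ (Filter.tendsto_id.const_mul_atBot hm)
    filter_upwards [Filter.eventually_le_atBot 0] with t ht
    simpa [hF0] using mul_sub_le_of_le_hasDerivAt hF hmc ht
  have hcont : Continuous F := continuous_iff_continuousAt.2 fun t => (hF t).continuousAt
  exact ⟨hmono.orderIsoOfSurjective F (hcont.surjective htop hbot), hc, hm, hmc, hF, hF0⟩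

namespace IsFlow

variable {m : ℝ} {c : ℝ → ℝ} {ξ : ℝ ≃o ℝ}

theorem speed_pos (h : IsFlow m c ξ) (t : ℝ) : 0 < c t := h.lower_pos.trans_le (h.le_speed t)

theorem anti (h : IsFlow m c ξ) {m' : ℝ} (hm' : 0 < m') (hle : m' ≤ m) : IsFlow m' c ξ :=
  { h with lower_pos := hm', le_speed := fun t => hle.trans (h.le_speed t) }

theorem map_pos (h : IsFlow m c ξ) {t : ℝ} : 0 < ξ t ↔ 0 < t := by
  rw [← h.map_zero, ξ.lt_iff_lt, h.map_zero]

theorem contDiff (h : IsFlow m c ξ) : ContDiff ℝ 1 ξ := by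
  rw [contDiff_one_iff_deriv, show deriv ξ = c from funext fun t => (h.hasDerivAt t).deriv]
  exact ⟨fun t => (h.hasDerivAt t).differentiableAt, h.speed_continuous⟩

theorem mul_sub_le (h : IsFlow m c ξ) {s t : ℝ} (hst : s ≤ t) : m * (t - s) ≤ ξ t - ξ s :=
  mul_sub_le_of_le_hasDerivAt h.hasDerivAt h.le_speed hst

theorem setIntegral_image_comp_symm (h : IsFlow m c ξ) {s : Set ℝ} (hs : MeasurableSet s)
    (f : ℝ → ℝ) : ∫ r in ξ '' s, f (ξ.symm r) = ∫ t in s, c t * f t := by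
  rw [integral_image_eq_integral_deriv_smul_of_monotoneOn hs
    (fun t _ => (h.hasDerivAt t).hasDerivWithinAt) (ξ.monotone.monotoneOn s)]
  simp only [OrderIso.symm_apply_apply, smul_eq_mul]

theorem integral_comp_symm (h : IsFlow m c ξ) (f : ℝ → ℝ) :
    ∫ r, f (ξ.symm r) = ∫ t, c t * f t := by
  simpa [ξ.surjective.range_eq] using h.setIntegral_image_comp_symm MeasurableSet.univ f

theorem intervalIntegral_comp_symm (h : IsFlow m c ξ) (f : ℝ → ℝ) (a b : ℝ) :
    ∫ r in a..b, f (ξ.symm r) = ∫ t in ξ.symm a..ξ.symm b, c t * f t := by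
  have hIoc : ∀ a b, ∫ r in Ioc a b, f (ξ.symm r) = ∫ t in Ioc (ξ.symm a) (ξ.symm b), c t * f t :=
    fun a b => by
      rw [← h.setIntegral_image_comp_symm measurableSet_Ioc, ξ.image_Ioc, ξ.apply_symm_apply,
        ξ.apply_symm_apply]
  simp only [intervalIntegral, hIoc]

theorem integrable_comp_symm_iff (h : IsFlow m c ξ) {f : ℝ → ℝ} :
    Integrable (fun r => f (ξ.symm r)) ↔ Integrable fun t => c t * f t := by
  simpa [ξ.surjective.range_eq] using integrableOn_image_iff_integrableOn_deriv_smul_of_monotoneOn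
    MeasurableSet.univ (fun t _ => (h.hasDerivAt t).hasDerivWithinAt) (ξ.monotone.monotoneOn univ)
    (fun r => f (ξ.symm r))

end IsFlow

end Flow

section Profile

/-- The density transported by a flow, in the coordinate `z = x - ξ t` that labels the
characteristics: `r` is the initial density, and the characteristic `z < 0` enters at time
`ξ.symm (-z)` with the inflow `v` divided by the speed. Data are extended by zero. -/
noncomputable def profile (c : ℝ → ℝ) (ξ : ℝ ≃o ℝ) (r v : ℝ → ℝ) (z : ℝ) : ℝ :=
  r z + v (ξ.symm (-z)) / c (ξ.symm (-z))

/-- The primitive of the profile that vanishes at zero. -/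
noncomputable def cumulative (ξ : ℝ ≃o ℝ) (r v : ℝ → ℝ) (z : ℝ) : ℝ :=
  (∫ x in (0 : ℝ)..z, r x) - ∫ t in (0 : ℝ)..ξ.symm (-z), v t

/-- The integral over `[b, d]` of the density transported by the flow `ξ`, at time `t`: the
nonlocal quantity on which the velocity depends. -/
noncomputable def nonlocalMass (b d : ℝ) (ξ : ℝ ≃o ℝ) (r v : ℝ → ℝ) (t : ℝ) : ℝ :=
  cumulative ξ r v (d - ξ t) - cumulative ξ r v (b - ξ t)

/-- The flow through `x = 1` of the transported density. -/
noncomputable def outflow (c : ℝ → ℝ) (ξ : ℝ ≃o ℝ) (r v : ℝ → ℝ) (t : ℝ) : ℝ :=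
  c t * profile c ξ r v (1 - ξ t)

variable {m T K₁ K₂ b d : ℝ} {c : ℝ → ℝ} {ξ : ℝ ≃o ℝ} {r v : ℝ → ℝ}

theorem isBoundedDatum_profile (h : IsFlow m c ξ) (hT : 0 < T)
    (hr : IsBoundedDatum (Ioo 0 1) K₁ r) (hv : IsBoundedDatum (Ioo 0 T) K₂ v) :
    IsBoundedDatum (Ioo (-ξ T) 1) (K₁ + K₂ / m) (profile c ξ r v) := by
  have hξT : 0 < ξ T := h.map_pos.2 hT
  refine ⟨?_, fun z => ?_, fun z hz => ?_⟩
  · have hsymm : Measurable fun z => ξ.symm (-z) :=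
      (ξ.symm.continuous.comp continuous_neg).measurable
    exact hr.measurable.add
      ((hv.measurable.comp hsymm).div (h.speed_continuous.measurable.comp hsymm))
  · refine (abs_add_le _ _).trans (add_le_add (hr.abs_le z) ?_)
    rw [abs_div, abs_of_pos (h.speed_pos _)]
    exact div_le_div₀ hv.bound_nonneg (hv.abs_le _) h.lower_pos (h.le_speed _)
  · have hrz : r z = 0 := hr.eq_zero z fun hz' => hz ⟨by linarith [hz'.1], hz'.2⟩
    have hvz : v (ξ.symm (-z)) = 0 := hv.eq_zero _ fun hz' => hz
      ⟨by linarith [ξ.symm_apply_lt.1 hz'.2],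
        by linarith [h.map_zero, ξ.lt_symm_apply.1 hz'.1]⟩
    rw [profile, hrz, hvz, zero_div, add_zero]

theorem profile_nonneg (h : IsFlow m c ξ) (hr : ∀ x, 0 ≤ r x) (hv : ∀ t, 0 ≤ v t) (z : ℝ) :
    0 ≤ profile c ξ r v z :=
  add_nonneg (hr z) (div_nonneg (hv _) (h.speed_pos _).le)

theorem integral_profile (h : IsFlow m c ξ) (hr : Integrable r) (hv : Integrable v) (x₁ x₂ : ℝ) :
    ∫ z in x₁..x₂, profile c ξ r v z = cumulative ξ r v x₂ - cumulative ξ r v x₁ := by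
  have hcancel : (fun t => c t * (v t / c t)) = v :=
    funext fun t => mul_div_cancel₀ (v t) (h.speed_pos t).ne'
  have hentry : ∫ z in x₁..x₂, v (ξ.symm (-z)) / c (ξ.symm (-z)) =
      ∫ t in ξ.symm (-x₂)..ξ.symm (-x₁), v t := by
    rw [intervalIntegral.integral_comp_neg fun z => v (ξ.symm z) / c (ξ.symm z),
      h.intervalIntegral_comp_symm fun t => v t / c t, hcancel]
  have hint : Integrable fun z => v (ξ.symm (-z)) / c (ξ.symm (-z)) :=
    (h.integrable_comp_symm_iff (f := fun t => v t / c t) |>.2 (by rwa [hcancel])).comp_neg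
  unfold profile cumulative
  rw [intervalIntegral.integral_add hr.intervalIntegrable hint.intervalIntegrable, hentry,
    ← intervalIntegral.integral_interval_sub_left hr.intervalIntegrable hr.intervalIntegrable
      (a := 0),
    ← intervalIntegral.integral_interval_sub_left hv.intervalIntegrable hv.intervalIntegrable
      (a := 0)]
  ring

theorem integral_profile_sub (h : IsFlow m c ξ) (hr : Integrable r) (hv : Integrable v) (t : ℝ) :
    ∫ x in b..d, profile c ξ r v (x - ξ t) = nonlocalMass b d ξ r v t := by
  rw [intervalIntegral.integral_comp_sub_right, integral_profile h hr hv, nonlocalMass]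

theorem abs_nonlocalMass_le (hr : Integrable r) (hv : Integrable v) (t : ℝ) :
    |nonlocalMass b d ξ r v t| ≤ (∫ x, |r x|) + ∫ t, |v t| := by
  have hrd := abs_intervalIntegral_sub_le hr (b - ξ t) (d - ξ t)
  have hvd := abs_intervalIntegral_sub_le hv (ξ.symm (-(d - ξ t))) (ξ.symm (-(b - ξ t)))
  unfold nonlocalMass cumulative
  rw [abs_le] at *
  constructor <;> linarith

theorem continuous_nonlocalMass (hr : Integrable r) (hv : Integrable v) :
    Continuous (nonlocalMass b d ξ r v) := by
  have hcum : Continuous (cumulative ξ r v) :=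
    (intervalIntegral.continuous_primitive (fun _ _ => hr.intervalIntegrable) 0).sub
      ((intervalIntegral.continuous_primitive (fun _ _ => hv.intervalIntegrable) 0).comp
        (ξ.symm.continuous.comp continuous_neg))
  exact (hcum.comp (continuous_const.sub ξ.continuous)).sub
    (hcum.comp (continuous_const.sub ξ.continuous))

theorem memLp_outflow (h : IsFlow m c ξ) (hT : 0 < T) (hr : IsBoundedDatum (Ioo 0 1) K₁ r)
    (hv : IsBoundedDatum (Ioo 0 T) K₂ v) :
    MemLp (outflow c ξ r v) ∞ (volume.restrict (Ioo 0 T)) := by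
  have hprof := isBoundedDatum_profile h hT hr hv
  obtain ⟨C, hC⟩ := isCompact_Icc.exists_bound_of_continuousOn
    (h.speed_continuous.continuousOn (s := Icc 0 T))
  refine MemLp.of_bound (C := C * (K₁ + K₂ / m)) (h.speed_continuous.measurable.mul
    (hprof.measurable.comp (ξ.continuous.measurable.const_sub 1))).aestronglyMeasurable ?_
  filter_upwards [ae_restrict_mem measurableSet_Ioo] with t ht
  have hCt := hC t (Ioo_subset_Icc_self ht)
  rw [outflow, norm_mul]
  exact mul_le_mul hCt (hprof.abs_le _) (norm_nonneg _) ((norm_nonneg _).trans hCt)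

theorem outflow_nonneg (h : IsFlow m c ξ) (hr : ∀ x, 0 ≤ r x) (hv : ∀ t, 0 ≤ v t) (t : ℝ) :
    0 ≤ outflow c ξ r v t :=
  mul_nonneg (h.speed_pos t).le (profile_nonneg h hr hv _)

end Profile

section MaterialDerivative

/-- The derivative `∂_t φ + c ∂_x φ` of a test function along the characteristics of speed `c`. -/
noncomputable def materialDeriv (c : ℝ → ℝ) (φ : ℝ → ℝ → ℝ) (t x : ℝ) : ℝ :=
  deriv (fun τ => φ τ x) t + c t * deriv (fun ξ => φ t ξ) x

variable {m : ℝ} {c : ℝ → ℝ} {ξ : ℝ ≃o ℝ} {φ : ℝ → ℝ → ℝ}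

theorem materialDeriv_eq_fderiv (hφ : Differentiable ℝ (Function.uncurry φ)) (t x : ℝ) :
    materialDeriv c φ t x = fderiv ℝ (Function.uncurry φ) (t, x) (1, c t) := by
  have hd := (hφ (t, x)).hasFDerivAt
  have ht : deriv (fun τ => φ τ x) t = fderiv ℝ (Function.uncurry φ) (t, x) (1, 0) :=
    (hd.comp_hasDerivAt (f := fun τ => (τ, x)) t
      ((hasDerivAt_id t).prodMk (hasDerivAt_const t x))).deriv
  have hx : deriv (fun ξ => φ t ξ) x = fderiv ℝ (Function.uncurry φ) (t, x) (0, 1) :=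
    (hd.comp_hasDerivAt (f := fun ξ => (t, ξ)) x
      ((hasDerivAt_const x t).prodMk (hasDerivAt_id x))).deriv
  rw [materialDeriv, ht, hx, ← smul_eq_mul, ← map_smul, ← map_add]
  simp

theorem continuous_materialDeriv (hc : Continuous c) (hφ : ContDiff ℝ 1 (Function.uncurry φ)) :
    Continuous (Function.uncurry (materialDeriv c φ)) := by
  have heq : Function.uncurry (materialDeriv c φ) =
      fun q => fderiv ℝ (Function.uncurry φ) q (1, c q.1) :=
    funext fun q => materialDeriv_eq_fderiv (hφ.differentiable one_ne_zero) q.1 q.2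
  rw [heq]
  exact (hφ.continuous_fderiv one_ne_zero).clm_apply
    (continuous_const.prodMk (hc.comp continuous_fst))

theorem IsFlow.hasDerivAt_comp (h : IsFlow m c ξ) (hφ : Differentiable ℝ (Function.uncurry φ))
    (z t : ℝ) : HasDerivAt (fun t => φ t (z + ξ t)) (materialDeriv c φ t (z + ξ t)) t := by
  rw [materialDeriv_eq_fderiv hφ]
  exact (hφ (t, z + ξ t)).hasFDerivAt.comp_hasDerivAt t
    ((hasDerivAt_id t).prodMk ((h.hasDerivAt t).const_add z))

end MaterialDerivative

section WeakIdentity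

theorem integral_integral_mul_comp_sub {g ξ : ℝ → ℝ} {D : ℝ → ℝ → ℝ} (hg : Integrable g)
    (hξ : Continuous ξ) (hD : Continuous (Function.uncurry D)) (a b a' b' : ℝ) :
    ∫ t in Ioo a b, ∫ x in Ioo a' b', g (x - ξ t) * D t x =
      ∫ z, g z * ∫ t in Ioo a b ∩ {t | z + ξ t ∈ Ioo a' b'}, D t (z + ξ t) := by
  let E : ℝ × ℝ → ℝ := (Ioo a b ×ˢ Ioo a' b').indicator (Function.uncurry D)
  have hshift : Measurable fun q : ℝ × ℝ => (q.1, q.2 + ξ q.1) :=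
    measurable_fst.prodMk (measurable_snd.add (hξ.measurable.comp measurable_fst))
  have hE : Measurable E := hD.measurable.indicator (measurableSet_Ioo.prod measurableSet_Ioo)
  obtain ⟨C, hC⟩ : ∃ C, ∀ q, ‖E q‖ ≤ C := by
    obtain ⟨C, hC⟩ := (isCompact_Icc.prod isCompact_Icc :
      IsCompact (Icc a b ×ˢ Icc a' b')).exists_bound_of_continuousOn hD.continuousOn
    refine ⟨|C|, fun q => ?_⟩
    by_cases hq : q ∈ Ioo a b ×ˢ Ioo a' b'
    · rw [show E q = _ from indicator_of_mem hq _]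
      exact (hC q ⟨Ioo_subset_Icc_self hq.1, Ioo_subset_Icc_self hq.2⟩).trans (le_abs_self C)
    · rw [show E q = _ from indicator_of_notMem hq _, norm_zero]
      exact abs_nonneg C
  have hint : Integrable (Function.uncurry fun t z => g z * E (t, z + ξ t))
      ((volume.restrict (Ioo a b)).prod volume) := by
    have hg' := (integrable_const (1 : ℝ) (μ := volume.restrict (Ioo a b))).mul_prod hg
    simp only [one_mul] at hg'
    exact hg'.mul_bdd (hE.comp hshift).aestronglyMeasurable
      (Filter.Eventually.of_forall fun q => hC (q.1, q.2 + ξ q.1))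
  calc ∫ t in Ioo a b, ∫ x in Ioo a' b', g (x - ξ t) * D t x
      = ∫ t in Ioo a b, ∫ z, g z * E (t, z + ξ t) := by
        refine setIntegral_congr_fun measurableSet_Ioo fun t ht => ?_
        rw [← integral_indicator measurableSet_Ioo, ← integral_add_right_eq_self _ (ξ t)]
        congr 1 with z
        by_cases hz : z + ξ t ∈ Ioo a' b'
        · simp [E, indicator, hz, ht, -mem_Ioo]
        · simp [E, indicator, hz, -mem_Ioo]
    _ = ∫ z, ∫ t in Ioo a b, g z * E (t, z + ξ t) := integral_integral_swap hint
    _ = _ := by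
        congr 1 with z
        have hpre : MeasurableSet {t | z + ξ t ∈ Ioo a' b'} :=
          (hξ.measurable.const_add z) measurableSet_Ioo
        rw [integral_const_mul, ← setIntegral_indicator hpre]
        congr 1
        refine setIntegral_congr_fun measurableSet_Ioo fun t ht => ?_
        simp [E, indicator, ht, -mem_Ioo]

variable {m T K₁ K₂ : ℝ} {c : ℝ → ℝ} {ξ : ℝ ≃o ℝ} {r v : ℝ → ℝ} {φ : ℝ → ℝ → ℝ}

theorem profile_mul_entry (h : IsFlow m c ξ) (hr : IsBoundedDatum (Ioo 0 1) K₁ r)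
    (hv : IsBoundedDatum (Ioo 0 T) K₂ v) (z : ℝ) :
    profile c ξ r v z * φ (max 0 (ξ.symm (-z))) (z + ξ (max 0 (ξ.symm (-z)))) =
      r z * φ 0 z + v (ξ.symm (-z)) / c (ξ.symm (-z)) * φ (ξ.symm (-z)) 0 := by
  rw [profile, add_mul]
  rcases le_or_gt z 0 with hz | hz
  · have hentry : 0 ≤ ξ.symm (-z) := by rw [ξ.le_symm_apply, h.map_zero]; linarith
    rw [hr.eq_zero z fun hz' => hz'.1.not_ge hz, max_eq_right hentry, ξ.apply_symm_apply]
    simp only [zero_mul, add_neg_cancel]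
  · have hentry : ξ.symm (-z) < 0 := by rw [ξ.symm_apply_lt, h.map_zero]; linarith
    rw [hv.eq_zero _ fun hz' => hz'.1.not_gt hentry, max_eq_left hentry.le, h.map_zero]
    simp only [zero_div, zero_mul, add_zero]

theorem comp_exit_eq_indicator (h : IsFlow m c ξ) (hφT : ∀ x ∈ Icc (0 : ℝ) 1, φ T x = 0) {z : ℝ}
    (hz : z ∈ Ioo (-ξ T) 1) :
    φ (min T (ξ.symm (1 - z))) (z + ξ (min T (ξ.symm (1 - z)))) =
      (Ioo 0 T).indicator (fun t => φ t 1) (ξ.symm (1 - z)) := by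
  have hexit : 0 < ξ.symm (1 - z) := by rw [ξ.lt_symm_apply, h.map_zero]; linarith [hz.2]
  rcases lt_or_ge (ξ.symm (1 - z)) T with hlt | hge
  · rw [min_eq_right hlt.le, ξ.apply_symm_apply,
      indicator_of_mem (show ξ.symm (1 - z) ∈ Ioo 0 T from ⟨hexit, hlt⟩), add_sub_cancel]
  · rw [min_eq_left hge, indicator_of_notMem fun h' => h'.2.not_ge hge]
    exact hφT _ ⟨by linarith [hz.1], by linarith [ξ.le_symm_apply.1 hge]⟩

theorem integral_materialDeriv_characteristic (h : IsFlow m c ξ) (hT : 0 < T)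
    (hφ : ContDiff ℝ 1 (Function.uncurry φ)) {z : ℝ} (hz : z ∈ Ioo (-ξ T) 1) :
    ∫ t in Ioo 0 T ∩ {t | z + ξ t ∈ Ioo (0 : ℝ) 1}, materialDeriv c φ t (z + ξ t) =
      φ (min T (ξ.symm (1 - z))) (z + ξ (min T (ξ.symm (1 - z)))) -
        φ (max 0 (ξ.symm (-z))) (z + ξ (max 0 (ξ.symm (-z)))) := by
  have hset : Ioo 0 T ∩ {t | z + ξ t ∈ Ioo (0 : ℝ) 1} =
      Ioo (max 0 (ξ.symm (-z))) (min T (ξ.symm (1 - z))) := by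
    have hpre : {t | z + ξ t ∈ Ioo (0 : ℝ) 1} = Ioo (ξ.symm (-z)) (ξ.symm (1 - z)) := by
      ext t
      simp only [mem_ofPred_eq, mem_Ioo, ξ.symm_apply_lt, ξ.lt_symm_apply, neg_lt_iff_pos_add',
        lt_sub_iff_add_lt']
    rw [hpre, Ioo_inter_Ioo]
  have hle : max 0 (ξ.symm (-z)) ≤ min T (ξ.symm (1 - z)) := by
    have hentry : ξ.symm (-z) ≤ T := by rw [ξ.symm_apply_le]; linarith [hz.1]
    have hexit : 0 ≤ ξ.symm (1 - z) := by rw [ξ.le_symm_apply, h.map_zero]; linarith [hz.2]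
    exact max_le (le_min hT.le hexit) (le_min hentry (ξ.symm.monotone (by linarith)))
  have hcont : Continuous fun t => materialDeriv c φ t (z + ξ t) :=
    (continuous_materialDeriv h.speed_continuous hφ).comp
      (continuous_id.prodMk (continuous_const.add ξ.continuous))
  rw [hset, ← integral_Ioc_eq_integral_Ioo, ← intervalIntegral.integral_of_le hle,
    intervalIntegral.integral_eq_sub_of_hasDerivAt
      (fun t _ => h.hasDerivAt_comp (hφ.differentiable one_ne_zero) z t)
      (hcont.intervalIntegrable _ _)]

theorem profile_mul_integral_characteristic (h : IsFlow m c ξ) (hT : 0 < T)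
    (hr : IsBoundedDatum (Ioo 0 1) K₁ r) (hv : IsBoundedDatum (Ioo 0 T) K₂ v)
    (hφ : ContDiff ℝ 1 (Function.uncurry φ)) (hφT : ∀ x ∈ Icc (0 : ℝ) 1, φ T x = 0) (z : ℝ) :
    profile c ξ r v z *
        ∫ t in Ioo 0 T ∩ {t | z + ξ t ∈ Ioo (0 : ℝ) 1}, materialDeriv c φ t (z + ξ t) =
      profile c ξ r v z * (Ioo 0 T).indicator (fun t => φ t 1) (ξ.symm (1 - z)) -
        (r z * φ 0 z + v (ξ.symm (-z)) / c (ξ.symm (-z)) * φ (ξ.symm (-z)) 0) := by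
  rw [← profile_mul_entry h hr hv]
  by_cases hz : z ∈ Ioo (-ξ T) 1
  · rw [integral_materialDeriv_characteristic h hT hφ hz, comp_exit_eq_indicator h hφT hz, mul_sub]
  · simp only [(isBoundedDatum_profile h hT hr hv).eq_zero z hz, zero_mul, sub_zero]

theorem integral_outflow (h : IsFlow m c ξ) (hT : 0 < T) (hr : IsBoundedDatum (Ioo 0 1) K₁ r)
    (hv : IsBoundedDatum (Ioo 0 T) K₂ v) {k : ℝ → ℝ} (hk : Continuous k) :
    Integrable (fun z => profile c ξ r v z * (Ioo 0 T).indicator k (ξ.symm (1 - z))) ∧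
      ∫ z, profile c ξ r v z * (Ioo 0 T).indicator k (ξ.symm (1 - z)) =
        ∫ t in Ioo 0 T, outflow c ξ r v t * k t := by
  let f : ℝ → ℝ := fun t => profile c ξ r v (1 - ξ t) * (Ioo 0 T).indicator k t
  have hf : ∀ z, profile c ξ r v z * (Ioo 0 T).indicator k (ξ.symm (1 - z)) =
      f (ξ.symm (1 - z)) := fun z => by simp [f]
  have hcf : (fun t => c t * f t) =
      (Ioo 0 T).indicator fun t => outflow c ξ r v t * k t := by
    ext t
    by_cases ht : t ∈ Ioo 0 T
    · simp only [f, outflow, indicator_of_mem ht, mul_assoc]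
    · simp only [f, indicator_of_notMem ht, mul_zero]
  have hint : IntegrableOn (fun t => outflow c ξ r v t * k t) (Ioo 0 T) := by
    have hout := (isBoundedDatum_profile h hT hr hv).indicator_comp
      (ξ.continuous.measurable.const_sub 1) (measurableSet_Ioo (a := 0) (b := T))
    refine (hout.integrable_mul (h.speed_continuous.mul hk)).integrableOn.congr_fun
      (fun t ht => ?_) measurableSet_Ioo
    simp only [indicator_of_mem ht, outflow, Pi.mul_apply]
    ring
  simp only [hf]
  refine ⟨(h.integrable_comp_symm_iff.2 ?_).comp_sub_left 1, ?_⟩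
  · rw [hcf]
    exact hint.integrable_indicator measurableSet_Ioo
  · rw [integral_sub_left_eq_self (fun z => f (ξ.symm z)), h.integral_comp_symm, hcf,
      integral_indicator measurableSet_Ioo]

theorem integral_inflow (h : IsFlow m c ξ) (hv : IsBoundedDatum (Ioo 0 T) K₂ v) {k : ℝ → ℝ}
    (hk : Continuous k) :
    Integrable (fun z => v (ξ.symm (-z)) / c (ξ.symm (-z)) * k (ξ.symm (-z))) ∧
      ∫ z, v (ξ.symm (-z)) / c (ξ.symm (-z)) * k (ξ.symm (-z)) = ∫ t in Ioo 0 T, v t * k t := by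
  let f : ℝ → ℝ := fun t => v t / c t * k t
  have hcf : (fun t => c t * f t) = fun t => v t * k t := by
    ext t
    rw [← mul_assoc, mul_div_cancel₀ _ (h.speed_pos t).ne']
  refine ⟨(h.integrable_comp_symm_iff (f := f) |>.2 ?_).comp_neg, ?_⟩
  · rw [hcf]
    exact hv.integrable_mul hk
  · rw [integral_neg_eq_self (fun z => f (ξ.symm z)), h.integral_comp_symm, hcf, hv.setIntegral]

theorem profile_weak_identity (h : IsFlow m c ξ) (hT : 0 < T)
    (hr : IsBoundedDatum (Ioo 0 1) K₁ r) (hv : IsBoundedDatum (Ioo 0 T) K₂ v)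
    (hφ : ContDiff ℝ 1 (Function.uncurry φ)) (hφT : ∀ x ∈ Icc (0 : ℝ) 1, φ T x = 0) :
    (∫ t in Ioo 0 T, ∫ x in Ioo (0 : ℝ) 1, profile c ξ r v (x - ξ t) * materialDeriv c φ t x)
      + (∫ x in Ioo (0 : ℝ) 1, r x * φ 0 x)
      + (∫ t in Ioo 0 T, v t * φ t 0)
      - (∫ t in Ioo 0 T, outflow c ξ r v t * φ t 1) = 0 := by
  have hφt : ∀ t, Continuous fun x => φ t x := fun t =>
    hφ.continuous.comp (continuous_const.prodMk continuous_id)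
  have hφx : ∀ x, Continuous fun t => φ t x := fun x =>
    hφ.continuous.comp (continuous_id.prodMk continuous_const)
  obtain ⟨hout_int, hout⟩ := integral_outflow h hT hr hv (hφx 1)
  obtain ⟨hin_int, hin⟩ := integral_inflow h hv (hφx 0)
  have hr_int := hr.integrable_mul (hφt 0)
  have hdata_int : Integrable fun z =>
      r z * φ 0 z + v (ξ.symm (-z)) / c (ξ.symm (-z)) * φ (ξ.symm (-z)) 0 := hr_int.add hin_int
  rw [integral_integral_mul_comp_sub (isBoundedDatum_profile h hT hr hv).integrable ξ.continuous
    (continuous_materialDeriv h.speed_continuous hφ)]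
  simp only [profile_mul_integral_characteristic h hT hr hv hφ hφT]
  rw [integral_sub hout_int hdata_int, integral_add hr_int hin_int, hout, hin,
    hr.setIntegral]
  ring

end WeakIdentity

section Lp

open Filter Topology

theorem restrict_uIoc_le_restrict_Ioo {a₀ b₀ a b : ℝ} (ha : a ∈ Icc a₀ b₀) (hb : b ∈ Icc a₀ b₀) :
    volume.restrict (uIoc a b) ≤ volume.restrict (Ioo a₀ b₀) := by
  rw [restrict_Ioo_eq_restrict_Ioc]
  exact Measure.restrict_mono (Ioc_subset_Ioc (le_min ha.1 hb.1) (max_le ha.2 hb.2)) le_rfl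

instance isProbabilityMeasure_restrict_Ioo_zero_one :
    IsProbabilityMeasure (volume.restrict (Ioo (0 : ℝ) 1)) := ⟨by simp⟩

section ProbabilityMeasure

variable {α X : Type*} [MeasurableSpace α] {μ : Measure α} [IsProbabilityMeasure μ]
  [TopologicalSpace X] [FirstCountableTopology X] {p : ℝ≥0∞} [Fact (1 ≤ p)]

theorem integrable_coeFn_Lp (f : Lp ℝ p μ) : Integrable f μ := (Lp.memLp f).integrable Fact.out

theorem integral_abs_le_norm_Lp (f : Lp ℝ p μ) : ∫ x, |f x| ∂μ ≤ ‖f‖ := by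
  have h := eLpNorm_le_eLpNorm_of_exponent_le (Fact.out : 1 ≤ p) (Lp.aestronglyMeasurable f)
  rw [eLpNorm_one_eq_lintegral_enorm] at h
  have h' := ENNReal.toReal_mono (Lp.eLpNorm_ne_top f) h
  rwa [← integral_norm_eq_lintegral_enorm (Lp.aestronglyMeasurable f), ← Lp.norm_def] at h'

theorem abs_integral_Lp_mul_le (f : Lp ℝ p μ) {ψ : α → ℝ} {C : ℝ} (hC : ∀ᵐ x ∂μ, |ψ x| ≤ C) :
    |∫ x, f x * ψ x ∂μ| ≤ C * ‖f‖ := by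
  have hC0 : 0 ≤ C := by
    obtain ⟨x, hx⟩ := hC.exists
    exact (abs_nonneg _).trans hx
  refine (norm_integral_le_of_norm_le (f := fun x => f x * ψ x)
    ((integrable_coeFn_Lp f).abs.const_mul C) ?_).trans ?_
  · filter_upwards [hC] with x hx
    rw [norm_mul, mul_comm]
    exact mul_le_mul_of_nonneg_right hx (norm_nonneg _)
  · rw [integral_const_mul]
    exact mul_le_mul_of_nonneg_left (integral_abs_le_norm_Lp f) hC0

theorem continuousOn_integral_mul {S : Set X} {ρ : X → Lp ℝ p μ} (hρ : ContinuousOn ρ S)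
    {ψ : X → α → ℝ} (hψ : ∀ t ∈ S, AEStronglyMeasurable (ψ t) μ) {C : ℝ}
    (hC : ∀ t ∈ S, ∀ᵐ x ∂μ, |ψ t x| ≤ C)
    (hcont : ∀ s ∈ S, ∀ᵐ x ∂μ, ContinuousWithinAt (fun t => ψ t x) S s) :
    ContinuousOn (fun t => ∫ x, ρ t x * ψ t x ∂μ) S := by
  intro s hs
  have hfixed : Tendsto (fun t => ∫ x, ρ s x * ψ t x ∂μ) (𝓝[S] s)
      (𝓝 (∫ x, ρ s x * ψ s x ∂μ)) := by
    refine tendsto_integral_filter_of_dominated_convergence (fun x => |ρ s x| * C) ?_ ?_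
      ((integrable_coeFn_Lp (ρ s)).abs.mul_const C) ?_
    · filter_upwards [self_mem_nhdsWithin] with t ht
      exact (Lp.aestronglyMeasurable _).mul (hψ t ht)
    · filter_upwards [self_mem_nhdsWithin] with t ht
      filter_upwards [hC t ht] with x hx
      rw [norm_mul]
      exact mul_le_mul_of_nonneg_left hx (abs_nonneg _)
    · filter_upwards [hcont s hs] with x hx using hx.const_mul _
  have hincrement : Tendsto (fun t => ∫ x, (ρ t - ρ s) x * ψ t x ∂μ) (𝓝[S] s) (𝓝 0) := by
    have hnorm : Tendsto (fun t => C * ‖ρ t - ρ s‖) (𝓝[S] s) (𝓝 0) := by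
      simpa using ((hρ s hs).sub_const (ρ s)).norm.const_mul C
    refine squeeze_zero_norm' ?_ hnorm
    filter_upwards [self_mem_nhdsWithin] with t ht using abs_integral_Lp_mul_le _ (hC t ht)
  refine (zero_add (∫ x, ρ s x * ψ s x ∂μ) ▸ hincrement.add hfixed).congr' ?_
  filter_upwards [self_mem_nhdsWithin] with t ht
  have hint : ∀ f : Lp ℝ p μ, Integrable (fun x => f x * ψ t x) μ := fun f =>
    (integrable_coeFn_Lp f).mul_bdd (hψ t ht) (hC t ht)
  rw [← integral_add (hint _) (hint _)]
  refine integral_congr_ae ?_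
  filter_upwards [Lp.coeFn_sub (ρ t) (ρ s)] with x hx
  rw [hx, Pi.sub_apply]
  ring

end ProbabilityMeasure

variable {p : ℝ≥0∞} [Fact (1 ≤ p)]

theorem continuous_intervalIntegral_LpUnit {b d : ℝ} (hb : b ∈ Icc (0 : ℝ) 1)
    (hd : d ∈ Icc (0 : ℝ) 1) : Continuous fun f : LpUnit p => ∫ z in b..d, f z := by
  have hle := restrict_uIoc_le_restrict_Ioo hb hd
  have hint : ∀ f : LpUnit p, IntervalIntegrable f volume b d := fun f =>
    intervalIntegrable_iff.2 ((integrable_coeFn_Lp f).mono_measure hle)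
  refine (LipschitzWith.of_dist_le_mul (K := 1) fun f g => ?_).continuous
  calc dist (∫ z in b..d, f z) (∫ z in b..d, g z)
      = ‖∫ z in b..d, (f - g) z‖ := by
        rw [dist_eq_norm, ← intervalIntegral.integral_sub (hint f) (hint g)]
        refine congrArg norm (intervalIntegral.integral_congr_ae_restrict ?_)
        filter_upwards [(Measure.absolutelyContinuous_of_le hle).ae_le (Lp.coeFn_sub f g)]
          with x hx using hx.symm
    _ ≤ ∫ z in Ioo (0 : ℝ) 1, |(f - g) z| :=
        intervalIntegral.norm_integral_le_integral_norm_uIoc.trans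
          (integral_mono_measure hle (Eventually.of_forall fun _ => norm_nonneg _)
            (integrable_coeFn_Lp (f - g)).norm)
    _ ≤ (1 : NNReal) * dist f g := by
        rw [NNReal.coe_one, one_mul, dist_eq_norm]
        exact integral_abs_le_norm_Lp (f - g)

theorem exists_continuous_translation_curve (hp : p ≠ ∞) {g : ℝ → ℝ} (hg : MemLp g p)
    {ξ : ℝ → ℝ} (hξ : Continuous ξ) (s : Set ℝ) :
    ∃ ρ : ℝ → Lp ℝ p (volume.restrict s), Continuous ρ ∧
      ∀ t, ρ t =ᵐ[volume.restrict s] fun x => g (x - ξ t) := by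
  have hmp : ∀ t, MeasurePreserving (fun x : ℝ => x - ξ t) volume volume :=
    fun t => measurePreserving_sub_right volume (ξ t)
  let shift : C(ℝ, C(ℝ, ℝ)) := (ContinuousMap.mk (fun q : ℝ × ℝ => q.2 - ξ q.1)
    (continuous_snd.sub (hξ.comp continuous_fst))).curry
  refine ⟨fun t => LpToLpRestrictCLM ℝ ℝ ℝ volume p s
    (Lp.compMeasurePreserving (shift t) (hmp t) (hg.toLp g)), ?_, fun t => ?_⟩
  · exact (LpToLpRestrictCLM ℝ ℝ ℝ volume p s).continuous.comp
      (Continuous.compMeasurePreservingLp continuous_const shift.continuous hmp hp)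
  · refine (LpToLpRestrictCLM_coeFn ℝ s _).trans (ae_restrict_of_ae ?_)
    refine (Lp.coeFn_compMeasurePreserving _ (hmp t)).trans ?_
    exact (hmp t).quasiMeasurePreserving.ae_eq_comp hg.coeFn_toLp

end Lp

section TransportSolution

/-- Weak solutions of `∂_t ρ + c(t) ∂_x ρ = 0` for a prescribed speed: the linear counterpart of
`IsLinkWeakSolution`. -/
def IsTransportSolution (T : ℝ) {p : ℝ≥0∞} (c ρ₀ u y : ℝ → ℝ) (ρ : ℝ → LpUnit p) : Prop :=
  ∀ φ : ℝ → ℝ → ℝ, ContDiff ℝ 1 (Function.uncurry φ) → (∀ x ∈ Icc (0 : ℝ) 1, φ T x = 0) →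
    (∫ t in Ioo 0 T, ∫ x in Ioo (0 : ℝ) 1, ρ t x * materialDeriv c φ t x)
      + (∫ x in Ioo (0 : ℝ) 1, ρ₀ x * φ 0 x)
      + (∫ t in Ioo 0 T, u t * φ t 0)
      - (∫ t in Ioo 0 T, y t * φ t 1) = 0

variable {T : ℝ} {p : ℝ≥0∞} {b d : ℝ} {c c' ρ₀ ρ₀' u u' y y' : ℝ → ℝ} {ρ ρ' : ℝ → LpUnit p}

theorem isLinkWeakSolution_iff {lam : ℝ → ℝ → ℝ} : IsLinkWeakSolution T b d lam ρ₀ u y ρ ↔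
    IsTransportSolution T (fun t => lam t (∫ z in b..d, ρ t z)) ρ₀ u y ρ := Iff.rfl

theorem setIntegral_mul_congr_ae {s : Set ℝ} {f g k : ℝ → ℝ} (hfg : f =ᵐ[volume.restrict s] g) :
    ∫ x in s, f x * k x = ∫ x in s, g x * k x :=
  integral_congr_ae (hfg.mul (Filter.EventuallyEq.refl _ k))

theorem IsTransportSolution.congr (h : IsTransportSolution T c ρ₀ u y ρ)
    (hρ : ∀ t ∈ Ioo 0 T, ρ t = ρ' t) (hc : ∀ t ∈ Ioo 0 T, c t = c' t)
    (hρ₀ : ρ₀ =ᵐ[volume.restrict (Ioo 0 1)] ρ₀') (hu : u =ᵐ[volume.restrict (Ioo 0 T)] u')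
    (hy : y =ᵐ[volume.restrict (Ioo 0 T)] y') : IsTransportSolution T c' ρ₀' u' y' ρ' := by
  intro φ hφ hφT
  have hinterior : ∫ t in Ioo 0 T, ∫ x in Ioo (0 : ℝ) 1, ρ t x * materialDeriv c φ t x =
      ∫ t in Ioo 0 T, ∫ x in Ioo (0 : ℝ) 1, ρ' t x * materialDeriv c' φ t x :=
    setIntegral_congr_fun measurableSet_Ioo fun t ht => by
      simp only [materialDeriv, hc t ht, hρ t ht]
  rw [← hinterior, ← setIntegral_mul_congr_ae hρ₀, ← setIntegral_mul_congr_ae hu,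
    ← setIntegral_mul_congr_ae hy]
  exact h φ hφ hφT

end TransportSolution

section Uniqueness

theorem ae_eq_restrict_of_integral_mul_contDiff_eq {E : Type*} [NormedAddCommGroup E]
    [NormedSpace ℝ E] [FiniteDimensional ℝ E] [MeasurableSpace E] [BorelSpace E] {μ : Measure E}
    {U : Set E} (hU : IsOpen U) {f g : E → ℝ} (hf : IntegrableOn f U μ) (hg : IntegrableOn g U μ)
    (h : ∀ k : E → ℝ, ContDiff ℝ (⊤ : ℕ∞) k → HasCompactSupport k → tsupport k ⊆ U →
      ∫ x in U, f x * k x ∂μ = ∫ x in U, g x * k x ∂μ) : f =ᵐ[μ.restrict U] g := by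
  have hzero := hU.ae_eq_zero_of_integral_contDiff_smul_eq_zero (hf.sub hg).locallyIntegrableOn
    fun k hk hkc hkU => by
      obtain ⟨C, hC⟩ := hkc.exists_bound_of_continuous hk.continuous
      have hint : ∀ {f}, IntegrableOn f U μ → IntegrableOn (fun x => f x * k x) U μ := fun hf =>
        hf.mul_bdd hk.continuous.aestronglyMeasurable (Filter.Eventually.of_forall hC)
      have hoff : ∀ x, x ∉ U → k x • (f - g) x = 0 := fun x hx => by
        rw [image_eq_zero_of_notMem_tsupport fun hx' => hx (hkU hx'), zero_smul]
      rw [← setIntegral_eq_integral_of_forall_compl_eq_zero hoff]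
      simp only [smul_eq_mul, Pi.sub_apply, mul_comm (k _), sub_mul]
      rw [integral_sub (hint hf) (hint hg), h k hk hkc hkU, sub_self]
  rw [Filter.EventuallyEq, ae_restrict_iff' hU.measurableSet]
  filter_upwards [hzero] with x hx hxU using sub_eq_zero.1 (hx hxU)

variable {p : ℝ≥0∞} {m T t₀ : ℝ} {c : ℝ → ℝ} {ξ : ℝ ≃o ℝ} {ρ₀ u y y₁ y₂ : ℝ → ℝ}
  {ρ ρ₁ ρ₂ : ℝ → LpUnit p} {ψ : ℝ → ℝ}

theorem IsFlow.materialDeriv_mul_comp_sub (h : IsFlow m c ξ) {A : ℝ → ℝ} {t a : ℝ}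
    (hA : HasDerivAt A a t) (hψ : Differentiable ℝ ψ) (x : ℝ) :
    materialDeriv c (fun t x => A t * ψ (x - ξ t)) t x = a * ψ (x - ξ t) := by
  have hψ' := (hψ (x - ξ t)).hasDerivAt
  have ht : HasDerivAt (fun t => A t * ψ (x - ξ t))
      (a * ψ (x - ξ t) + A t * (deriv ψ (x - ξ t) * -c t)) t :=
    hA.mul (hψ'.comp t ((h.hasDerivAt t).const_sub x))
  have hx : HasDerivAt (fun x => A t * ψ (x - ξ t)) (A t * (deriv ψ (x - ξ t) * 1)) x :=
    (hψ'.comp x ((hasDerivAt_id x).sub_const (ξ t))).const_mul (A t)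
  rw [materialDeriv, ht.deriv, hx.deriv]
  ring

namespace IsTransportSolution

/-- The test function is `ψ`, constant along the characteristics, times a primitive of `a`. As it
vanishes at the outflow boundary, the right-hand side depends on the data alone. -/
theorem integral_pairing (hρ : IsTransportSolution T c ρ₀ u y ρ) (h : IsFlow m c ξ) (ht₀ : t₀ ≤ T)
    {a : ℝ → ℝ} (ha : Continuous a) (ha₀ : ∀ t, t₀ ≤ t → a t = 0) (hψ : ContDiff ℝ 1 ψ)
    (hψ₀ : ∀ z, 1 - ξ t₀ ≤ z → ψ z = 0) :
    ∫ t in Ioo 0 T, a t * ∫ x in Ioo (0 : ℝ) 1, ρ t x * ψ (x - ξ t) =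
      - (∫ x in Ioo (0 : ℝ) 1, ρ₀ x * ((∫ s in T..0, a s) * ψ x))
      - ∫ t in Ioo 0 T, u t * ((∫ s in T..t, a s) * ψ (-ξ t)) := by
  let A : ℝ → ℝ := fun t => ∫ s in T..t, a s
  have hA : ∀ t, HasDerivAt A (a t) t := fun t => (ha.integral_hasStrictDerivAt T t).hasDerivAt
  have hA_contDiff : ContDiff ℝ 1 A := by
    rw [contDiff_one_iff_deriv, show deriv A = a from funext fun t => (hA t).deriv]
    exact ⟨fun t => (hA t).differentiableAt, ha⟩
  have hA₀ : ∀ t, t₀ ≤ t → A t = 0 := fun t ht =>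
    intervalIntegral.integral_zero_ae (Filter.Eventually.of_forall fun s hs =>
      ha₀ s ((le_min ht₀ ht).trans hs.1.le))
  have hφ : ContDiff ℝ 1 (Function.uncurry fun t x => A t * ψ (x - ξ t)) :=
    (hA_contDiff.comp contDiff_fst).mul
      (hψ.comp (contDiff_snd.sub (h.contDiff.comp contDiff_fst)))
  have hexit : ∀ t, A t * ψ (1 - ξ t) = 0 := fun t => by
    rcases le_total t₀ t with ht | ht
    · rw [hA₀ t ht, zero_mul]
    · rw [hψ₀ _ (sub_le_sub_left (ξ.monotone ht) 1), mul_zero]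
  have hid := hρ _ hφ fun x _ => by rw [hA₀ T ht₀, zero_mul]
  simp only [h.materialDeriv_mul_comp_sub (hA _) (hψ.differentiable one_ne_zero), hexit,
    mul_left_comm _ (a _), integral_const_mul, h.map_zero, mul_zero, integral_zero, sub_zero,
    zero_sub] at hid
  linarith

theorem outflow_unique (h₁ : IsTransportSolution T c ρ₀ u y₁ ρ)
    (h₂ : IsTransportSolution T c ρ₀ u y₂ ρ) (hy₁ : IntegrableOn y₁ (Ioo 0 T))
    (hy₂ : IntegrableOn y₂ (Ioo 0 T)) : y₁ =ᵐ[volume.restrict (Ioo 0 T)] y₂ := by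
  refine ae_eq_restrict_of_integral_mul_contDiff_eq isOpen_Ioo hy₁ hy₂ fun a ha _ ha_supp => ?_
  have hφ : ContDiff ℝ 1 (Function.uncurry fun t (_ : ℝ) => a t) :=
    (ha.of_le (by simp)).comp contDiff_fst
  have haT : a T = 0 := image_eq_zero_of_notMem_tsupport fun hT => (ha_supp hT).2.false
  linarith [h₁ _ hφ fun _ _ => haT, h₂ _ hφ fun _ _ => haT]

variable [Fact (1 ≤ p)]

theorem integral_mul_comp_sub_eq (h₁ : IsTransportSolution T c ρ₀ u y₁ ρ₁)
    (h₂ : IsTransportSolution T c ρ₀ u y₂ ρ₂) (h : IsFlow m c ξ)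
    (hρ₁ : ContinuousOn ρ₁ (Icc 0 T)) (hρ₂ : ContinuousOn ρ₂ (Icc 0 T)) (ht₀ : t₀ ∈ Ioc 0 T)
    (hψ : ContDiff ℝ 1 ψ) (hψc : HasCompactSupport ψ) (hψ₀ : ∀ z, 1 - ξ t₀ ≤ z → ψ z = 0) :
    ∫ x in Ioo (0 : ℝ) 1, ρ₁ t₀ x * ψ (x - ξ t₀) =
      ∫ x in Ioo (0 : ℝ) 1, ρ₂ t₀ x * ψ (x - ξ t₀) := by
  obtain ⟨C, hC⟩ := hψc.exists_bound_of_continuous hψ.continuous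
  let P : (ℝ → LpUnit p) → ℝ → ℝ := fun ρ t => ∫ x in Ioo (0 : ℝ) 1, ρ t x * ψ (x - ξ t)
  have hP : ∀ {ρ}, ContinuousOn ρ (Icc 0 T) → ContinuousOn (P ρ) (Icc 0 t₀) := fun hρ =>
    continuousOn_integral_mul (hρ.mono (Icc_subset_Icc_right ht₀.2))
      (fun t _ => (hψ.continuous.comp (continuous_sub_right (ξ t))).aestronglyMeasurable)
      (fun t _ => Filter.Eventually.of_forall fun x => hC (x - ξ t))
      fun s _ => Filter.Eventually.of_forall fun x =>
        (hψ.continuous.comp (continuous_const.sub ξ.continuous)).continuousWithinAt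
  have hint : ∀ {ρ}, ContinuousOn ρ (Icc 0 T) → IntegrableOn (P ρ) (Ioo 0 t₀) := fun hρ =>
    (hP hρ).integrableOn_Icc.mono_set Ioo_subset_Icc_self
  have hae : P ρ₁ =ᵐ[volume.restrict (Ioo 0 t₀)] P ρ₂ := by
    refine ae_eq_restrict_of_integral_mul_contDiff_eq isOpen_Ioo (hint hρ₁) (hint hρ₂)
      fun a ha _ ha_supp => ?_
    have ha₀ : ∀ t, t ∉ Ioo 0 t₀ → a t = 0 := fun t ht =>
      image_eq_zero_of_notMem_tsupport fun ht' => ht (ha_supp ht')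
    have hextend : ∀ ρ, ∫ t in Ioo 0 t₀, P ρ t * a t = ∫ t in Ioo 0 T, a t * P ρ t := fun ρ => by
      simp only [mul_comm (P ρ _)]
      exact (setIntegral_eq_of_subset_of_forall_sdiff_eq_zero measurableSet_Ioo
        (Ioo_subset_Ioo_right ht₀.2) fun t ht => by rw [ha₀ t ht.2, zero_mul]).symm
    have ha₀' : ∀ t, t₀ ≤ t → a t = 0 := fun t ht => ha₀ t fun ht' => ht'.2.not_ge ht
    rw [hextend, hextend, h₁.integral_pairing h ht₀.2 ha.continuous ha₀' hψ hψ₀,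
      h₂.integral_pairing h ht₀.2 ha.continuous ha₀' hψ hψ₀]
  rw [restrict_Ioo_eq_restrict_Icc] at hae
  exact Measure.eqOn_Icc_of_ae_eq volume ht₀.1.ne hae (hP hρ₁) (hP hρ₂)
    (right_mem_Icc.2 ht₀.1.le)

theorem density_unique (h₁ : IsTransportSolution T c ρ₀ u y₁ ρ₁)
    (h₂ : IsTransportSolution T c ρ₀ u y₂ ρ₂) (h : IsFlow m c ξ) (hT : 0 < T)
    (hρ₁ : ContinuousOn ρ₁ (Icc 0 T)) (hρ₂ : ContinuousOn ρ₂ (Icc 0 T)) :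
    EqOn ρ₁ ρ₂ (Icc 0 T) := by
  have hpos : EqOn ρ₁ ρ₂ (Ioc 0 T) := fun t₀ ht₀ => by
    refine Lp.ext (ae_eq_restrict_of_integral_mul_contDiff_eq isOpen_Ioo
      (integrable_coeFn_Lp _) (integrable_coeFn_Lp _) fun k hk hkc hk_supp => ?_)
    have hshift : ∀ z, 1 - ξ t₀ ≤ z → k (z + ξ t₀) = 0 := fun z hz =>
      image_eq_zero_of_notMem_tsupport fun hz' => by linarith [(hk_supp hz').2]
    simpa using h₁.integral_mul_comp_sub_eq h₂ h hρ₁ hρ₂ ht₀ (ψ := fun z => k (z + ξ t₀))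
      ((hk.of_le (by simp)).comp (contDiff_id.add contDiff_const))
      (hkc.comp_homeomorph (Homeomorph.addRight (ξ t₀))) hshift
  exact hpos.of_subset_closure hρ₁ hρ₂ Ioc_subset_Icc_self (closure_Ioc hT.ne).ge

theorem unique (h₁ : IsTransportSolution T c ρ₀ u y₁ ρ₁)
    (h₂ : IsTransportSolution T c ρ₀ u y₂ ρ₂) (h : IsFlow m c ξ) (hT : 0 < T)
    (hρ₁ : ContinuousOn ρ₁ (Icc 0 T)) (hρ₂ : ContinuousOn ρ₂ (Icc 0 T))
    (hy₁ : IntegrableOn y₁ (Ioo 0 T)) (hy₂ : IntegrableOn y₂ (Ioo 0 T)) :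
    EqOn ρ₁ ρ₂ (Icc 0 T) ∧ y₁ =ᵐ[volume.restrict (Ioo 0 T)] y₂ := by
  have hρ := h₁.density_unique h₂ h hT hρ₁ hρ₂
  exact ⟨hρ, h₁.outflow_unique (h₂.congr (fun t ht => (hρ (Ioo_subset_Icc_self ht)).symm)
    (fun _ _ => rfl) .rfl .rfl .rfl) hy₁ hy₂⟩

end IsTransportSolution

end Uniqueness

section WeightedFixedPoint

theorem existsUnique_isFixedPt_of_weighted_contraction {X E : Type*} [TopologicalSpace X]
    [CompactSpace X] [MetricSpace E] [CompleteSpace E] [Nonempty E] {w : X → ℝ}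
    (hw : Continuous w) (hw_one : ∀ x, 1 ≤ w x) {q : ℝ} (hq : 0 ≤ q) (hq_one : q < 1)
    (Φ : C(X, E) → C(X, E))
    (hΦ : ∀ (f g : C(X, E)) (D : ℝ), 0 ≤ D → (∀ x, dist (f x) (g x) ≤ D * w x) →
      ∀ x, dist (Φ f x) (Φ g x) ≤ q * D * w x) : ∃! f, Function.IsFixedPt Φ f := by
  have hiter : ∀ (n : ℕ) (f g : C(X, E)) (x : X),
      dist (Φ^[n] f x) (Φ^[n] g x) ≤ q ^ n * dist f g * w x := fun n f g => by
    induction n with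
    | zero =>
      intro x
      rw [pow_zero, one_mul]
      exact (ContinuousMap.dist_apply_le_dist x).trans
        (le_mul_of_one_le_right dist_nonneg (hw_one x))
    | succ n ih =>
      intro x
      rw [Function.iterate_succ_apply', Function.iterate_succ_apply', pow_succ', mul_assoc q]
      exact hΦ _ _ _ (by positivity) ih x
  obtain ⟨C, hC⟩ := isCompact_univ.exists_bound_of_continuousOn hw.continuousOn
  have hlim : Filter.Tendsto (fun n : ℕ => q ^ n * C) Filter.atTop (nhds (0 * C)) :=
    (tendsto_pow_atTop_nhds_zero_of_lt_one hq hq_one).mul_const C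
  obtain ⟨n, hn⟩ := (hlim.eventually_lt_const (by simp : 0 * C < 1)).exists
  -- The weight changes distances by a factor of at most `C`, which the iterates outweigh.
  have hcontract : ContractingWith (q ^ n * C).toNNReal Φ^[n] := by
    refine ⟨Real.toNNReal_lt_one.2 hn, LipschitzWith.of_dist_le_mul fun f g =>
      (ContinuousMap.dist_le (by positivity)).2 fun x => ?_⟩
    calc dist (Φ^[n] f x) (Φ^[n] g x) ≤ q ^ n * dist f g * w x := hiter n f g x
      _ ≤ q ^ n * dist f g * C := by
        gcongr
        exact (le_abs_self _).trans (hC x (mem_univ x))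
      _ = q ^ n * C * dist f g := by ring
      _ ≤ (q ^ n * C).toNNReal * dist f g := by gcongr; exact Real.le_coe_toNNReal _
  have : Nonempty C(X, E) := ⟨.const X (Classical.arbitrary E)⟩
  exact ⟨_, hcontract.isFixedPt_fixedPoint_iterate, fun g hg =>
    hcontract.fixedPoint_unique (hg.iterate n)⟩

end WeightedFixedPoint

section Stability

theorem IsBoundedDatum.abs_intervalIntegral_sub_le_mul {K a b : ℝ} {f : ℝ → ℝ}
    (hf : IsBoundedDatum (Ioo a b) K f) (x₁ x₂ : ℝ) :
    |(∫ x in (0 : ℝ)..x₂, f x) - ∫ x in (0 : ℝ)..x₁, f x| ≤ K * |x₂ - x₁| := by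
  have hint := hf.integrable
  rw [intervalIntegral.integral_interval_sub_left hint.intervalIntegrable hint.intervalIntegrable]
  exact intervalIntegral.norm_integral_le_of_norm_le_const fun x _ =>
    (Real.norm_eq_abs _).trans_le (hf.abs_le x)

theorem IsBoundedDatum.intervalIntegral_max_zero {K T : ℝ} {f : ℝ → ℝ}
    (hf : IsBoundedDatum (Ioo 0 T) K f) (x : ℝ) :
    ∫ t in (0 : ℝ)..max 0 x, f t = ∫ t in (0 : ℝ)..x, f t := by
  rcases le_total 0 x with hx | hx
  · rw [max_eq_right hx]
  · rw [max_eq_left hx, intervalIntegral.integral_same]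
    refine (intervalIntegral.integral_zero_ae (Filter.Eventually.of_forall fun t ht => ?_)).symm
    rw [uIoc_of_ge hx] at ht
    exact hf.eq_zero t fun ht' => ht.2.not_gt ht'.1

variable {m T K₁ K₂ D κ E t x b d : ℝ} {c₁ c₂ : ℝ → ℝ} {ξ₁ ξ₂ : ℝ ≃o ℝ} {r v : ℝ → ℝ}

theorem IsFlow.abs_sub_le {m₁ m₂ : ℝ} (h₁ : IsFlow m₁ c₁ ξ₁) (h₂ : IsFlow m₂ c₂ ξ₂) (hκ : 0 < κ)
    (hc : ∀ s ∈ Icc 0 T, |c₁ s - c₂ s| ≤ D * Real.exp (κ * s)) (ht : t ∈ Icc 0 T) :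
    |ξ₁ t - ξ₂ t| ≤ D / κ * Real.exp (κ * t) := by
  have hD : 0 ≤ D := by
    simpa using (abs_nonneg _).trans (hc 0 (left_mem_Icc.2 (ht.1.trans ht.2)))
  have hbound : ∀ s, HasDerivAt (fun s => D / κ * Real.exp (κ * s)) (D * Real.exp (κ * s)) s :=
    fun s => ((((hasDerivAt_id s).const_mul κ).exp).const_mul (D / κ)).congr_deriv <| by
      simp only [id, mul_one]
      field_simp
  refine image_norm_le_of_norm_deriv_right_le_deriv_boundary (f := fun s => ξ₁ s - ξ₂ s)
    (f' := fun s => c₁ s - c₂ s) (ξ₁.continuous.sub ξ₂.continuous).continuousOn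
    (fun s _ => ((h₁.hasDerivAt s).sub (h₂.hasDerivAt s)).hasDerivWithinAt) ?_ hbound
    (fun s hs => hc s (Ico_subset_Icc_self hs)) ht
  rw [h₁.map_zero, h₂.map_zero, sub_self, norm_zero]
  positivity

theorem IsFlow.symm_sub_symm_le (h₂ : IsFlow m c₂ ξ₂)
    (hE : ∀ s ∈ Icc 0 t, |ξ₁ s - ξ₂ s| ≤ E) (hx : 0 ≤ x) (hpos : 0 ≤ ξ₁.symm (ξ₁ t - x)) :
    ξ₁.symm (ξ₁ t - x) - ξ₂.symm (ξ₂ t - x) ≤ 2 * E / m := by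
  have hle : ξ₁.symm (ξ₁ t - x) ≤ t := ξ₁.symm_apply_le.2 (sub_le_self _ hx)
  have hE_entry := abs_le.1 (hE _ ⟨hpos, hle⟩)
  have hE_now := abs_le.1 (hE t ⟨hpos.trans hle, le_rfl⟩)
  rw [le_div_iff₀ h₂.lower_pos]
  rcases le_total (ξ₂.symm (ξ₂ t - x)) (ξ₁.symm (ξ₁ t - x)) with hlt | hlt
  · have hspeed := h₂.mul_sub_le hlt
    rw [ξ₂.apply_symm_apply] at hspeed
    rw [ξ₁.apply_symm_apply] at hE_entry
    linarith [hE_entry.1, hE_now.2]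
  · nlinarith [h₂.lower_pos, hE_now.1, hE_now.2]

theorem IsFlow.abs_max_symm_sub_max_symm_le (h₁ : IsFlow m c₁ ξ₁) (h₂ : IsFlow m c₂ ξ₂)
    (ht : 0 ≤ t) (hE : ∀ s ∈ Icc 0 t, |ξ₁ s - ξ₂ s| ≤ E) (hx : 0 ≤ x) :
    |max 0 (ξ₁.symm (ξ₁ t - x)) - max 0 (ξ₂.symm (ξ₂ t - x))| ≤ 2 * E / m := by
  have hE₀ : 0 ≤ E := (abs_nonneg _).trans (hE t (right_mem_Icc.2 ht))
  have hone_sided : ∀ {c₂ : ℝ → ℝ} {ξ₁ ξ₂ : ℝ ≃o ℝ}, IsFlow m c₂ ξ₂ →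
      (∀ s ∈ Icc 0 t, |ξ₁ s - ξ₂ s| ≤ E) →
      max 0 (ξ₁.symm (ξ₁ t - x)) - max 0 (ξ₂.symm (ξ₂ t - x)) ≤ 2 * E / m := by
    intro c₂ ξ₁ ξ₂ h₂ hE
    rcases le_total (ξ₁.symm (ξ₁ t - x)) 0 with hneg | hpos
    · rw [max_eq_left hneg, zero_sub]
      exact (neg_nonpos.2 (le_max_left _ _)).trans
        (div_nonneg (by positivity) h₂.lower_pos.le)
    · rw [max_eq_right hpos]
      exact (sub_le_sub_left (le_max_right _ _) _).trans (h₂.symm_sub_symm_le hE hx hpos)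
  exact abs_sub_le_iff.2 ⟨hone_sided h₂ hE,
    hone_sided h₁ fun s hs => by rw [abs_sub_comm]; exact hE s hs⟩

theorem abs_cumulative_sub_cumulative_le (h₁ : IsFlow m c₁ ξ₁) (h₂ : IsFlow m c₂ ξ₂)
    (hr : IsBoundedDatum (Ioo 0 1) K₁ r) (hv : IsBoundedDatum (Ioo 0 T) K₂ v) (ht : 0 ≤ t)
    (hE : ∀ s ∈ Icc 0 t, |ξ₁ s - ξ₂ s| ≤ E) (hx : 0 ≤ x) :
    |cumulative ξ₁ r v (x - ξ₁ t) - cumulative ξ₂ r v (x - ξ₂ t)| ≤ (K₁ + 2 * K₂ / m) * E := by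
  have hinitial : |(∫ z in (0 : ℝ)..x - ξ₁ t, r z) - ∫ z in (0 : ℝ)..x - ξ₂ t, r z| ≤ K₁ * E := by
    refine (hr.abs_intervalIntegral_sub_le_mul _ _).trans
      (mul_le_mul_of_nonneg_left ?_ hr.bound_nonneg)
    rw [sub_sub_sub_cancel_left, abs_sub_comm]
    exact hE t (right_mem_Icc.2 ht)
  have hentered : |(∫ s in (0 : ℝ)..ξ₁.symm (ξ₁ t - x), v s) -
      ∫ s in (0 : ℝ)..ξ₂.symm (ξ₂ t - x), v s| ≤ K₂ * (2 * E / m) := by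
    rw [← hv.intervalIntegral_max_zero, ← hv.intervalIntegral_max_zero (ξ₂.symm _)]
    exact (hv.abs_intervalIntegral_sub_le_mul _ _).trans (mul_le_mul_of_nonneg_left
      (h₁.abs_max_symm_sub_max_symm_le h₂ ht hE hx) hv.bound_nonneg)
  rw [cumulative, cumulative, neg_sub, neg_sub, sub_sub_sub_comm]
  refine (abs_sub _ _).trans ((add_le_add hinitial hentered).trans_eq ?_)
  ring

theorem abs_nonlocalMass_sub_nonlocalMass_le (h₁ : IsFlow m c₁ ξ₁) (h₂ : IsFlow m c₂ ξ₂)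
    (hr : IsBoundedDatum (Ioo 0 1) K₁ r) (hv : IsBoundedDatum (Ioo 0 T) K₂ v) (hb : 0 ≤ b)
    (hd : 0 ≤ d) (hκ : 0 < κ) (hc : ∀ s ∈ Icc 0 T, |c₁ s - c₂ s| ≤ D * Real.exp (κ * s))
    (ht : t ∈ Icc 0 T) :
    |nonlocalMass b d ξ₁ r v t - nonlocalMass b d ξ₂ r v t| ≤
      2 * (K₁ + 2 * K₂ / m) * (D / κ * Real.exp (κ * t)) := by
  have hD : 0 ≤ D := by
    simpa using (abs_nonneg _).trans (hc 0 (left_mem_Icc.2 (ht.1.trans ht.2)))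
  have hE : ∀ s ∈ Icc 0 t, |ξ₁ s - ξ₂ s| ≤ D / κ * Real.exp (κ * t) := fun s hs => by
    have hst := hs.2
    exact (h₁.abs_sub_le h₂ hκ hc ⟨hs.1, hst.trans ht.2⟩).trans (by gcongr)
  rw [nonlocalMass, nonlocalMass, sub_sub_sub_comm]
  refine (abs_sub _ _).trans ((add_le_add
    (abs_cumulative_sub_cumulative_le h₁ h₂ hr hv ht.1 hE hd)
    (abs_cumulative_sub_cumulative_le h₁ h₂ hr hv ht.1 hE hb)).trans_eq ?_)
  ring

theorem nonlocalMass_congr {m₁ m₂ : ℝ} (h₁ : IsFlow m₁ c₁ ξ₁) (h₂ : IsFlow m₂ c₂ ξ₂)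
    (hr : IsBoundedDatum (Ioo 0 1) K₁ r) (hv : IsBoundedDatum (Ioo 0 T) K₂ v) (hb : 0 ≤ b)
    (hd : 0 ≤ d) (hc : EqOn c₁ c₂ (Icc 0 T)) :
    EqOn (nonlocalMass b d ξ₁ r v) (nonlocalMass b d ξ₂ r v) (Icc 0 T) := fun t ht => by
  have hm : 0 < min m₁ m₂ := lt_min h₁.lower_pos h₂.lower_pos
  have hle := abs_nonlocalMass_sub_nonlocalMass_le (h₁.anti hm (min_le_left _ _))
    (h₂.anti hm (min_le_right _ _)) hr hv hb hd one_pos (D := 0)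
    (fun s hs => by simp [hc hs]) ht
  rw [zero_div, zero_mul, mul_zero] at hle
  exact sub_eq_zero.1 (abs_nonpos_iff.1 hle)

end Stability

section Velocity

/-- The velocities for which the nonlocal equation is well posed: jointly continuous and positive
on `[0, T] × ℝ`, and Lipschitz in the nonlocal mass, on bounded sets and uniformly in time. -/
structure IsLipschitzVelocity (T : ℝ) (lam : ℝ → ℝ → ℝ) : Prop where
  continuousOn : ContinuousOn (Function.uncurry lam) (Icc 0 T ×ˢ univ)
  pos : ∀ t ∈ Icc 0 T, ∀ w, 0 < lam t w
  lipschitzOnWith : ∀ B : ℝ, ∃ L : NNReal, ∀ t ∈ Icc 0 T, LipschitzOnWith L (lam t) (Icc (-B) B)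

variable {T : ℝ} {lam : ℝ → ℝ → ℝ}

theorem IsVelocity.isLipschitzVelocity (h : IsVelocity T lam) : IsLipschitzVelocity T lam := by
  refine ⟨h.1.continuousOn, h.2, fun B => ?_⟩
  have hsub : Icc 0 T ×ˢ Icc (-B) B ⊆ Icc 0 T ×ˢ univ := prod_mono_right (subset_univ _)
  have hlocal : LocallyLipschitzOn (Icc 0 T ×ˢ Icc (-B) B) (Function.uncurry lam) := fun q hq => by
    obtain ⟨L, s, hs, hL⟩ :=
      (h.1 q (hsub hq)).exists_lipschitzOnWith ((convex_Icc 0 T).prod convex_univ)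
    exact ⟨L, s, nhdsWithin_mono q hsub hs, hL⟩
  obtain ⟨L, hL⟩ := hlocal.exists_lipschitzOnWith_of_compact (isCompact_Icc.prod isCompact_Icc)
  exact ⟨L, fun t ht => LipschitzOnWith.of_dist_le_mul fun w hw w' hw' => by
    simpa [Prod.dist_eq] using hL.dist_le_mul (t, w) ⟨ht, hw⟩ (t, w') ⟨ht, hw'⟩⟩

theorem IsLipschitzVelocity.exists_pos_le (h : IsLipschitzVelocity T lam) (B : ℝ) :
    ∃ m > 0, ∀ t ∈ Icc 0 T, ∀ w ∈ Icc (-B) B, m ≤ lam t w := by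
  obtain ⟨m, hm, hle⟩ := (isCompact_Icc.prod isCompact_Icc).exists_forall_le'
    (h.continuousOn.mono (prod_mono_right (subset_univ (Icc (-B) B)))) fun q hq => h.pos _ hq.1 _
  exact ⟨m, hm, fun t ht w hw => hle (t, w) ⟨ht, hw⟩⟩

theorem IsLipschitzVelocity.continuousOn_comp (h : IsLipschitzVelocity T lam) {W : ℝ → ℝ}
    (hW : ContinuousOn W (Icc 0 T)) : ContinuousOn (fun t => lam t (W t)) (Icc 0 T) :=
  h.continuousOn.comp (continuousOn_id.prodMk hW) fun _ ht => ⟨ht, mem_univ _⟩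

theorem exists_isFlow_eqOn_Icc {m : ℝ} {c : ℝ → ℝ} (hT : 0 ≤ T) (hm : 0 < m)
    (hc : ContinuousOn c (Icc 0 T)) (hmc : ∀ t ∈ Icc 0 T, m ≤ c t) :
    ∃ c' ξ, IsFlow m c' ξ ∧ EqOn c' c (Icc 0 T) := by
  obtain ⟨ξ, hξ⟩ := exists_isFlow (continuousOn_iff_continuous_domRestrict.1 hc).Icc_extend' hm
    fun t => hmc _ (projIcc 0 T hT t).2
  exact ⟨_, ξ, hξ, fun t ht => IccExtend_of_mem hT _ ht⟩

end Velocity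

section SelfConsistentFlow

/-- The flow `ξ` transports the data `r`, `v` in such a way that the nonlocal mass it produces
determines, through `lam`, its own speed `c`. -/
structure IsSelfConsistentFlow (T b d : ℝ) (lam : ℝ → ℝ → ℝ) (r v : ℝ → ℝ) (m : ℝ) (c : ℝ → ℝ)
    (ξ : ℝ ≃o ℝ) : Prop extends IsFlow m c ξ where
  speed_eq : ∀ t ∈ Icc 0 T, c t = lam t (nonlocalMass b d ξ r v t)

variable {m T K₁ K₂ B L b d : ℝ} {r v : ℝ → ℝ} {lam : ℝ → ℝ → ℝ}

/-- The nonlocal mass on `[0, T]`, as a continuous curve in an interval to which the total mass of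
the data confines it. -/
noncomputable def nonlocalMassCurve (T b d : ℝ) (ξ : ℝ ≃o ℝ) (hr : Integrable r)
    (hv : Integrable v) (hB : (∫ x, |r x|) + ∫ t, |v t| ≤ B) : C(Icc 0 T, Icc (-B) B) where
  toFun t := ⟨nonlocalMass b d ξ r v t, abs_le.1 ((abs_nonlocalMass_le hr hv t).trans hB)⟩
  continuous_toFun :=
    ((continuous_nonlocalMass hr hv).comp continuous_subtype_val).subtype_mk _

theorem existsUnique_nonlocalMassCurve_eq (hr : IsBoundedDatum (Ioo 0 1) K₁ r)
    (hv : IsBoundedDatum (Ioo 0 T) K₂ v) (hb : 0 ≤ b) (hd : 0 ≤ d) (hL : 0 ≤ L)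
    (hB : (∫ x, |r x|) + ∫ t, |v t| ≤ B) {c : C(Icc 0 T, Icc (-B) B) → ℝ → ℝ}
    {ξ : C(Icc 0 T, Icc (-B) B) → ℝ ≃o ℝ} (hξ : ∀ W, IsFlow m (c W) (ξ W))
    (hc : ∀ W W' (t : Icc 0 T), |c W t - c W' t| ≤ L * dist (W t) (W' t)) :
    ∃! W, nonlocalMassCurve T b d (ξ W) hr.integrable hv.integrable hB = W := by
  have : Nonempty (Icc (-B) B) := by
    have hB₀ : 0 ≤ B := le_trans (by positivity) hB
    exact ⟨0, by simpa using hB₀⟩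
  let A : ℝ := K₁ + 2 * K₂ / m
  let κ : ℝ := 4 * A * L + 1
  have hA : 0 ≤ A := by
    have hm := (hξ (.const _ (Classical.arbitrary _))).lower_pos
    have hK₁ := hr.bound_nonneg
    have hK₂ := hv.bound_nonneg
    positivity
  have hκ : 0 < κ := by positivity
  refine existsUnique_isFixedPt_of_weighted_contraction (q := 1 / 2)
    (w := fun t : Icc 0 T => Real.exp (κ * t)) (by fun_prop)
    (fun t => Real.one_le_exp (mul_nonneg hκ.le t.2.1)) (by norm_num) (by norm_num) _
    fun W W' D hD hW t => ?_
  have hspeed : ∀ s ∈ Icc 0 T, |c W s - c W' s| ≤ L * D * Real.exp (κ * s) := fun s hs =>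
    (hc W W' ⟨s, hs⟩).trans ((mul_le_mul_of_nonneg_left (hW ⟨s, hs⟩) hL).trans_eq
      (mul_assoc L D _).symm)
  have hfactor : 2 * A * (L * D / κ) ≤ 1 / 2 * D := by
    rw [← mul_div_assoc, div_le_iff₀ hκ]
    linarith [mul_assoc A L D]
  calc |nonlocalMass b d (ξ W) r v t - nonlocalMass b d (ξ W') r v t|
      ≤ 2 * A * (L * D / κ * Real.exp (κ * t)) :=
        abs_nonlocalMass_sub_nonlocalMass_le (hξ W) (hξ W') hr hv hb hd hκ hspeed t.2
    _ = 2 * A * (L * D / κ) * Real.exp (κ * t) := (mul_assoc _ _ _).symm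
    _ ≤ 1 / 2 * D * Real.exp (κ * t) := by gcongr

theorem exists_unique_isSelfConsistentFlow (hT : 0 ≤ T) (hb : 0 ≤ b) (hd : 0 ≤ d)
    (hlam : IsLipschitzVelocity T lam) (hr : IsBoundedDatum (Ioo 0 1) K₁ r)
    (hv : IsBoundedDatum (Ioo 0 T) K₂ v) :
    ∃ m c ξ, IsSelfConsistentFlow T b d lam r v m c ξ ∧
      ∀ m' c' ξ', IsSelfConsistentFlow T b d lam r v m' c' ξ' → EqOn c' c (Icc 0 T) := by
  let B : ℝ := (∫ x, |r x|) + ∫ t, |v t|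
  obtain ⟨m, hm, hmlam⟩ := hlam.exists_pos_le B
  obtain ⟨L, hL⟩ := hlam.lipschitzOnWith B
  choose c ξ hξ hc_ext using fun W : C(Icc 0 T, Icc (-B) B) =>
    exists_isFlow_eqOn_Icc hT hm
      (hlam.continuousOn_comp (continuous_subtype_val.comp (W.continuous.Icc_extend')).continuousOn)
      fun t ht => hmlam t ht _ (IccExtend hT W t).2
  have hc : ∀ (W : C(Icc 0 T, Icc (-B) B)) (t : Icc 0 T), c W t = lam t (W t) := fun W t => by
    simpa using hc_ext W t.2
  obtain ⟨W, hW, huniq⟩ := existsUnique_nonlocalMassCurve_eq hr hv hb hd L.2 le_rfl hξ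
    fun W W' t => by
      rw [hc, hc]
      exact (hL t t.2).dist_le_mul _ (W t).2 _ (W' t).2
  refine ⟨m, c W, ξ W, ⟨hξ W, fun t ht => ?_⟩, fun m' c' ξ' h' t ht => ?_⟩
  · have hWt := congrArg Subtype.val (DFunLike.congr_fun hW ⟨t, ht⟩)
    exact (hc W ⟨t, ht⟩).trans (congrArg (lam t) hWt.symm)
  · let W' := nonlocalMassCurve T b d ξ' hr.integrable hv.integrable (le_refl B)
    have hc' : EqOn (c W') c' (Icc 0 T) := fun s hs =>
      (hc W' ⟨s, hs⟩).trans (h'.speed_eq s hs).symm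
    have hW' : W' = W := huniq W' <| ContinuousMap.ext fun s => Subtype.ext <|
      nonlocalMass_congr (hξ W') h'.toIsFlow hr hv hb hd hc' s.2
    rw [← hc' ht, hW']

end SelfConsistentFlow

section Link

variable {T m K₁ K₂ b d : ℝ} {p : ℝ≥0∞} [Fact (1 ≤ p)] {lam : ℝ → ℝ → ℝ} {c r v : ℝ → ℝ}
  {ξ : ℝ ≃o ℝ} {ρ₀ u u' y y' : ℝ → ℝ} {ρ ρ' : ℝ → LpUnit p}

theorem exists_isTransportSolution_profile (hp : p ≠ ∞) (h : IsFlow m c ξ) (hT : 0 < T)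
    (hr : IsBoundedDatum (Ioo 0 1) K₁ r) (hv : IsBoundedDatum (Ioo 0 T) K₂ v) :
    ∃ ρ : ℝ → LpUnit p, Continuous ρ ∧
      (∀ t, ρ t =ᵐ[volume.restrict (Ioo 0 1)] fun x => profile c ξ r v (x - ξ t)) ∧
      IsTransportSolution T c r v (outflow c ξ r v) ρ := by
  obtain ⟨ρ, hρc, hρ⟩ := exists_continuous_translation_curve hp
    ((isBoundedDatum_profile h hT hr hv).memLp p) ξ.continuous (Ioo 0 1)
  refine ⟨ρ, hρc, hρ, fun φ hφ hφT => ?_⟩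
  simp only [setIntegral_mul_congr_ae (hρ _)]
  exact profile_weak_identity h hT hr hv hφ hφT

theorem intervalIntegral_eq_nonlocalMass (h : IsFlow m c ξ) (hb : b ∈ Icc (0 : ℝ) 1)
    (hd : d ∈ Icc (0 : ℝ) 1) (hr : Integrable r) (hv : Integrable v) {f : ℝ → ℝ} {t : ℝ}
    (hf : f =ᵐ[volume.restrict (Ioo 0 1)] fun x => profile c ξ r v (x - ξ t)) :
    ∫ z in b..d, f z = nonlocalMass b d ξ r v t := by
  rw [← integral_profile_sub h hr hv]
  exact intervalIntegral.integral_congr_ae_restrict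
    ((Measure.absolutelyContinuous_of_le (restrict_uIoc_le_restrict_Ioo hb hd)).ae_le hf)

theorem exists_isLinkWeakSolution (hT : 0 < T) (hp : p ≠ ∞) (hb : b ∈ Icc (0 : ℝ) 1)
    (hd : d ∈ Icc (0 : ℝ) 1) (hlam : IsLipschitzVelocity T lam)
    (hρ₀ : MemLp ρ₀ ∞ (volume.restrict (Ioo 0 1))) (hu : MemLp u ∞ (volume.restrict (Ioo 0 T))) :
    ∃ (ρ : ℝ → LpUnit p) (y : ℝ → ℝ), InSolutionSpace T p ρ ∧
      MemLp y ∞ (volume.restrict (Ioo 0 T)) ∧ IsLinkWeakSolution T b d lam ρ₀ u y ρ ∧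
      ((∀ᵐ x ∂volume.restrict (Ioo 0 1), 0 ≤ ρ₀ x) →
        (∀ᵐ t ∂volume.restrict (Ioo 0 T), 0 ≤ u t) →
        (∀ t, ∀ᵐ x ∂volume.restrict (Ioo (0 : ℝ) 1), 0 ≤ ρ t x) ∧
          ∀ᵐ t ∂volume.restrict (Ioo 0 T), 0 ≤ y t) := by
  obtain ⟨K₁, r, hr, hrρ, hr0⟩ := exists_isBoundedDatum measurableSet_Ioo hρ₀
  obtain ⟨K₂, v, hv, hvu, hv0⟩ := exists_isBoundedDatum measurableSet_Ioo hu
  obtain ⟨m, c, ξ, h, -⟩ := exists_unique_isSelfConsistentFlow hT.le hb.1 hd.1 hlam hr hv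
  have hflow := h.toIsFlow
  obtain ⟨ρ, hρc, hρ, hsol⟩ := exists_isTransportSolution_profile hp hflow hT hr hv
  refine ⟨ρ, outflow c ξ r v, ⟨hρc.continuousOn, K₁ + K₂ / m, .of_forall fun t => ?_⟩,
    memLp_outflow hflow hT hr hv, ?_, fun hρ₀0 hu0 => ⟨fun t => ?_,
      .of_forall (outflow_nonneg hflow (hr0 hρ₀0) (hv0 hu0))⟩⟩
  · filter_upwards [hρ t] with x hx
    exact hx ▸ (isBoundedDatum_profile hflow hT hr hv).abs_le _
  · exact hsol.congr (fun _ _ => rfl) (fun t ht => by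
      rw [h.speed_eq t (Ioo_subset_Icc_self ht), intervalIntegral_eq_nonlocalMass hflow hb hd
        hr.integrable hv.integrable (hρ t)]) hrρ hvu .rfl
  · filter_upwards [hρ t] with x hx
    exact hx ▸ profile_nonneg hflow (hr0 hρ₀0) (hv0 hu0) _

theorem IsLinkWeakSolution.exists_isSelfConsistentFlow (h : IsLinkWeakSolution T b d lam r v y ρ)
    (hT : 0 < T) (hp : p ≠ ∞) (hb : b ∈ Icc (0 : ℝ) 1) (hd : d ∈ Icc (0 : ℝ) 1)
    (hlam : IsLipschitzVelocity T lam) (hr : IsBoundedDatum (Ioo 0 1) K₁ r)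
    (hv : IsBoundedDatum (Ioo 0 T) K₂ v) (hρ : ContinuousOn ρ (Icc 0 T))
    (hy : IntegrableOn y (Ioo 0 T)) :
    ∃ m c ξ, IsSelfConsistentFlow T b d lam r v m c ξ ∧ IsTransportSolution T c r v y ρ := by
  have hcont : ContinuousOn (fun t => lam t (∫ z in b..d, ρ t z)) (Icc 0 T) :=
    hlam.continuousOn_comp ((continuous_intervalIntegral_LpUnit hb hd).comp_continuousOn hρ)
  obtain ⟨m, hm, hmc⟩ := isCompact_Icc.exists_forall_le' hcont fun t ht => hlam.pos t ht _
  obtain ⟨c, ξ, hξ, hc⟩ := exists_isFlow_eqOn_Icc hT.le hm hcont hmc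
  have hsol : IsTransportSolution T c r v y ρ :=
    (isLinkWeakSolution_iff.1 h).congr (fun _ _ => rfl)
      (fun t ht => (hc (Ioo_subset_Icc_self ht)).symm) .rfl .rfl .rfl
  obtain ⟨ρ', hρ'c, hρ', hsol'⟩ := exists_isTransportSolution_profile hp hξ hT hr hv
  have hρρ' : EqOn ρ ρ' (Icc 0 T) := (hsol.unique hsol' hξ hT hρ hρ'c.continuousOn hy
    ((memLp_outflow hξ hT hr hv).integrable le_top)).1
  refine ⟨m, c, ξ, ⟨hξ, fun t ht => (hc ht).trans (congrArg (lam t) ?_)⟩, hsol⟩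
  exact intervalIntegral_eq_nonlocalMass hξ hb hd hr.integrable hv.integrable
    (hρρ' ht ▸ hρ' t)

theorem IsLinkWeakSolution.unique (h : IsLinkWeakSolution T b d lam ρ₀ u y ρ)
    (h' : IsLinkWeakSolution T b d lam ρ₀ u' y' ρ') (hT : 0 < T) (hp : p ≠ ∞)
    (hb : b ∈ Icc (0 : ℝ) 1) (hd : d ∈ Icc (0 : ℝ) 1) (hlam : IsLipschitzVelocity T lam)
    (hρ₀ : MemLp ρ₀ ∞ (volume.restrict (Ioo 0 1))) (hu : MemLp u ∞ (volume.restrict (Ioo 0 T)))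
    (huu' : u =ᵐ[volume.restrict (Ioo 0 T)] u') (hρ : ContinuousOn ρ (Icc 0 T))
    (hρ' : ContinuousOn ρ' (Icc 0 T)) (hy : IntegrableOn y (Ioo 0 T))
    (hy' : IntegrableOn y' (Ioo 0 T)) :
    EqOn ρ ρ' (Icc 0 T) ∧ y =ᵐ[volume.restrict (Ioo 0 T)] y' := by
  obtain ⟨K₁, r, hr, hrρ, -⟩ := exists_isBoundedDatum measurableSet_Ioo hρ₀
  obtain ⟨K₂, v, hv, hvu, -⟩ := exists_isBoundedDatum measurableSet_Ioo hu
  have hrep : IsLinkWeakSolution T b d lam r v y ρ := (isLinkWeakSolution_iff.1 h).congr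
    (fun _ _ => rfl) (fun _ _ => rfl) hrρ.symm hvu.symm .rfl
  have hrep' : IsLinkWeakSolution T b d lam r v y' ρ' := (isLinkWeakSolution_iff.1 h').congr
    (fun _ _ => rfl) (fun _ _ => rfl) hrρ.symm (huu'.symm.trans hvu.symm) .rfl
  obtain ⟨m, c, ξ, hself, hsol⟩ :=
    hrep.exists_isSelfConsistentFlow hT hp hb hd hlam hr hv hρ hy
  obtain ⟨m', c', ξ', hself', hsol'⟩ :=
    hrep'.exists_isSelfConsistentFlow hT hp hb hd hlam hr hv hρ' hy'
  obtain ⟨-, c₀, -, -, hunique⟩ :=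
    exists_unique_isSelfConsistentFlow hT.le hb.1 hd.1 hlam hr hv
  have hcc' : EqOn c' c (Icc 0 T) :=
    (hunique _ _ _ hself').trans (hunique _ _ _ hself).symm
  exact hsol.unique (hsol'.congr (fun _ _ => rfl) (fun t ht => hcc' (Ioo_subset_Icc_self ht))
    .rfl .rfl .rfl) hself.toIsFlow hT hρ hρ' hy hy'

end Link

section Network

theorem exists_forall_eq_of_wellFounded {ι β : Type*} [Nonempty β] {R : ι → ι → Prop}
    (hR : WellFounded R) {Φ : ι → (ι → β) → β}
    (hΦ : ∀ a f g, (∀ a', R a' a → f a' = g a') → Φ a f = Φ a g) :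
    ∃ f : ι → β, ∀ a, f a = Φ a f := by
  classical
  refine ⟨hR.fix fun a ih => Φ a fun a' =>
    if h : R a' a then ih a' h else Classical.arbitrary β, fun a => ?_⟩
  rw [hR.fix_eq]
  exact hΦ a _ _ fun a' ha' => dif_pos ha'

namespace Network

variable {N : Network}

theorem Acyclic.wellFounded (hN : N.Acyclic) :
    WellFounded fun a' a : N.Link => target a' = origin a := by
  let R : N.Link → N.Link → Prop := fun a' a => target a' = origin a
  have hstep : ∀ a' a, R a' a → (origin a', origin a) ∈ N.links := fun a' a h => by
    rw [← show target a' = origin a from h]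
    exact a'.2
  have : Std.Irrefl (Relation.TransGen R) := ⟨fun a ha => hN (origin a) (ha.lift origin hstep)⟩
  exact (Finite.wellFounded_of_trans_of_irrefl (Relation.TransGen R)).mono
    fun _ _ => Relation.TransGen.single (r := R)

theorem origin_mem_nodes (a : N.Link) : origin a ∈ N.nodes :=
  (Finset.mem_product.1 (N.links_subset a.2)).1

theorem mem_inLinks {v : ℕ} {a : N.Link} : a ∈ N.inLinks v ↔ target a = v := by
  simp [inLinks]

theorem mem_outLinks {v : ℕ} {a : N.Link} : a ∈ N.outLinks v ↔ origin a = v := by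
  simp [outLinks]

/-- The inflow of the link `a` that conservation of flow at its origin prescribes when the links of
the network have the outflows `y`. -/
def nodeInflow (N : Network) (θ s y : N.Link → ℝ → ℝ) (a : N.Link) (t : ℝ) : ℝ :=
  s a t + θ a t * ∑ a' ∈ N.inLinks (origin a), y a' t

variable {θ s y y' : N.Link → ℝ → ℝ} {a : N.Link} {μ : Measure ℝ}

theorem nodeInflow_congr (h : ∀ a', target a' = origin a → y a' = y' a') :
    N.nodeInflow θ s y a = N.nodeInflow θ s y' a := by
  funext t
  simp only [nodeInflow]
  rw [Finset.sum_congr rfl fun a' ha' => congrFun (h a' (mem_inLinks.1 ha')) t]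

theorem nodeInflow_congr_ae (h : ∀ a', target a' = origin a → y a' =ᵐ[μ] y' a') :
    N.nodeInflow θ s y a =ᵐ[μ] N.nodeInflow θ s y' a := by
  have hall : ∀ᵐ t ∂μ, ∀ a' ∈ N.inLinks (origin a), y a' t = y' a' t :=
    (Filter.eventually_all_finset _).2 fun a' ha' => h a' (mem_inLinks.1 ha')
  filter_upwards [hall] with t ht
  rw [nodeInflow, nodeInflow, Finset.sum_congr rfl ht]

theorem memLp_top_nodeInflow (hθ : MemLp (θ a) ∞ μ) (hs : MemLp (s a) ∞ μ)
    (hy : ∀ a', target a' = origin a → MemLp (y a') ∞ μ) : MemLp (N.nodeInflow θ s y a) ∞ μ :=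
  hs.add ((memLp_finsetSum _ fun a' ha' => hy a' (mem_inLinks.1 ha')).mul hθ)

theorem nodeInflow_nonneg_ae (hθ : ∀ᵐ t ∂μ, 0 ≤ θ a t) (hs : ∀ᵐ t ∂μ, 0 ≤ s a t)
    (hy : ∀ a', target a' = origin a → ∀ᵐ t ∂μ, 0 ≤ y a' t) :
    ∀ᵐ t ∂μ, 0 ≤ N.nodeInflow θ s y a t := by
  have hall : ∀ᵐ t ∂μ, ∀ a' ∈ N.inLinks (origin a), 0 ≤ y a' t :=
    (Filter.eventually_all_finset _).2 fun a' ha' => hy a' (mem_inLinks.1 ha')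
  filter_upwards [hθ, hs, hall] with t hθt hst hyt
  exact add_nonneg hst (mul_nonneg hθt (Finset.sum_nonneg hyt))

end Network

variable {N : Network} {T b d : ℝ} {p : ℝ≥0∞} [Fact (1 ≤ p)] {lam : N.Link → ℝ → ℝ → ℝ}
  {ρ₀ θ s u u' y y' : N.Link → ℝ → ℝ} {ρ ρ' : N.Link → ℝ → LpUnit p}

theorem IsNetworkWeakSolution.inflow_eq
    (h : IsNetworkWeakSolution N T p b d lam ρ₀ θ s ρ u y) (a : N.Link) :
    u a =ᵐ[volume.restrict (Ioo 0 T)] N.nodeInflow θ s y a := by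
  filter_upwards [h.node _ (Network.origin_mem_nodes a) a (Network.mem_outLinks.2 rfl)]
    with t ht using ht.symm

theorem exists_isNetworkWeakSolution (hN : N.Acyclic) (hT : 0 < T) (hp : p ≠ ∞)
    (hb : b ∈ Icc (0 : ℝ) 1) (hd : d ∈ Icc (0 : ℝ) 1)
    (hlam : ∀ a, IsLipschitzVelocity T (lam a))
    (hρ₀ : ∀ a, MemLp (ρ₀ a) ∞ (volume.restrict (Ioo 0 1)))
    (hθ : ∀ a, MemLp (θ a) ∞ (volume.restrict (Ioo 0 T)))
    (hs : ∀ a, MemLp (s a) ∞ (volume.restrict (Ioo 0 T))) :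
    ∃ (ρ : N.Link → ℝ → LpUnit p) (u y : N.Link → ℝ → ℝ),
      IsNetworkWeakSolution N T p b d lam ρ₀ θ s ρ u y ∧
      (∀ a, MemLp (u a) ∞ (volume.restrict (Ioo 0 T))) ∧
      ((∀ a, ∀ᵐ x ∂volume.restrict (Ioo 0 1), 0 ≤ ρ₀ a x) →
        (∀ a, ∀ᵐ t ∂volume.restrict (Ioo 0 T), 0 ≤ θ a t) →
        (∀ a, ∀ᵐ t ∂volume.restrict (Ioo 0 T), 0 ≤ s a t) →
        ∀ a, (∀ t, ∀ᵐ x ∂volume.restrict (Ioo (0 : ℝ) 1), 0 ≤ ρ a t x) ∧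
          (∀ᵐ t ∂volume.restrict (Ioo 0 T), 0 ≤ u a t) ∧
          ∀ᵐ t ∂volume.restrict (Ioo 0 T), 0 ≤ y a t) := by
  have hwf := hN.wellFounded
  choose! density outflow hspace houtflow hweak hnonneg using
    fun (a : N.Link) (u : ℝ → ℝ) (hu : MemLp u ∞ (volume.restrict (Ioo 0 T))) =>
      exists_isLinkWeakSolution (p := p) hT hp hb hd (hlam a) (hρ₀ a) hu
  obtain ⟨y, hy⟩ : ∃ y : N.Link → ℝ → ℝ, ∀ a, y a = outflow a (N.nodeInflow θ s y a) :=
    exists_forall_eq_of_wellFounded hwf fun a _ _ h =>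
      congrArg (outflow a) (Network.nodeInflow_congr h)
  have hu : ∀ a, MemLp (N.nodeInflow θ s y a) ∞ (volume.restrict (Ioo 0 T)) := fun a => by
    induction a using hwf.induction with
    | _ a ih =>
      refine Network.memLp_top_nodeInflow (hθ a) (hs a) fun a' ha' => ?_
      rw [hy a']
      exact houtflow a' _ (ih a' ha')
  have hy_mem : ∀ a, MemLp (y a) ∞ (volume.restrict (Ioo 0 T)) := fun a =>
    hy a ▸ houtflow a _ (hu a)
  refine ⟨fun a => density a (N.nodeInflow θ s y a), N.nodeInflow θ s y, y,
    ⟨fun a => hspace a _ (hu a), fun a => (hu a).integrable le_top,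
      fun a => (hy_mem a).integrable le_top, fun a => ?_, fun v _ a ha => ?_⟩, hu,
    fun hρ₀0 hθ0 hs0 => ?_⟩
  · rw [hy a]
    exact hweak a _ (hu a)
  · obtain rfl := Network.mem_outLinks.1 ha
    exact .of_forall fun _ => rfl
  · have hu0 : ∀ a, ∀ᵐ t ∂volume.restrict (Ioo 0 T), 0 ≤ N.nodeInflow θ s y a t := fun a => by
      induction a using hwf.induction with
      | _ a ih =>
        refine Network.nodeInflow_nonneg_ae (hθ0 a) (hs0 a) fun a' ha' => ?_
        rw [hy a']
        exact (hnonneg a' _ (hu a') (hρ₀0 a') (ih a' ha')).2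
    intro a
    obtain ⟨hρ0, hy0⟩ := hnonneg a _ (hu a) (hρ₀0 a) (hu0 a)
    exact ⟨hρ0, hu0 a, hy a ▸ hy0⟩

theorem IsNetworkWeakSolution.unique (h : IsNetworkWeakSolution N T p b d lam ρ₀ θ s ρ u y)
    (h' : IsNetworkWeakSolution N T p b d lam ρ₀ θ s ρ' u' y') (hN : N.Acyclic) (hT : 0 < T)
    (hp : p ≠ ∞) (hb : b ∈ Icc (0 : ℝ) 1) (hd : d ∈ Icc (0 : ℝ) 1)
    (hlam : ∀ a, IsLipschitzVelocity T (lam a))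
    (hρ₀ : ∀ a, MemLp (ρ₀ a) ∞ (volume.restrict (Ioo 0 1)))
    (hu : ∀ a, MemLp (u a) ∞ (volume.restrict (Ioo 0 T))) (a : N.Link) :
    EqOn (ρ a) (ρ' a) (Icc 0 T) ∧ u a =ᵐ[volume.restrict (Ioo 0 T)] u' a ∧
      y a =ᵐ[volume.restrict (Ioo 0 T)] y' a := by
  induction a using hN.wellFounded.induction with
  | _ a ih =>
    have huu' : u a =ᵐ[volume.restrict (Ioo 0 T)] u' a := (h.inflow_eq a).trans <|
      (Network.nodeInflow_congr_ae fun a' ha' => (ih a' ha').2.2).trans (h'.inflow_eq a).symm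
    obtain ⟨hρ, hy⟩ := (h.weak a).unique (h'.weak a) hT hp hb hd (hlam a) (hρ₀ a) (hu a) huu'
      (h.mem_space a).1 (h'.mem_space a).1 (h.outflow_integrable a) (h'.outflow_integrable a)
    exact ⟨hρ, huu', hy⟩

end Network

theorem mainTheorem1_general {N : Network} (hN : N.Acyclic) {T : ℝ} (hT : 0 < T) {p : ℝ≥0∞}
    [Fact (1 ≤ p)] (hp : p ≠ ∞) {b d : ℝ} (hb : b ∈ Icc (0 : ℝ) 1) (hd : d ∈ Icc (0 : ℝ) 1)
    {lam : N.Link → ℝ → ℝ → ℝ} (hlam : ∀ a, IsLipschitzVelocity T (lam a))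
    {ρ₀ θ s : N.Link → ℝ → ℝ} (hρ₀ : ∀ a, MemLp (ρ₀ a) ∞ (volume.restrict (Ioo 0 1)))
    (hθ : ∀ a, MemLp (θ a) ∞ (volume.restrict (Ioo 0 T)))
    (hs : ∀ a, MemLp (s a) ∞ (volume.restrict (Ioo 0 T))) :
    ∃ (ρ : N.Link → ℝ → LpUnit p) (u y : N.Link → ℝ → ℝ),
      IsNetworkWeakSolution N T p b d lam ρ₀ θ s ρ u y ∧
      ((∀ a, ∀ᵐ x ∂volume.restrict (Ioo 0 1), 0 ≤ ρ₀ a x) →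
        (∀ a, ∀ᵐ t ∂volume.restrict (Ioo 0 T), 0 ≤ θ a t) →
        (∀ a, ∀ᵐ t ∂volume.restrict (Ioo 0 T), 0 ≤ s a t) →
        ∀ a, (∀ t ∈ Icc 0 T, ∀ᵐ x ∂volume.restrict (Ioo (0 : ℝ) 1), 0 ≤ ρ a t x) ∧
          (∀ᵐ t ∂volume.restrict (Ioo 0 T), 0 ≤ u a t) ∧
          (∀ᵐ t ∂volume.restrict (Ioo 0 T), 0 ≤ y a t)) ∧
      ∀ (ρ' : N.Link → ℝ → LpUnit p) (u' y' : N.Link → ℝ → ℝ),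
        IsNetworkWeakSolution N T p b d lam ρ₀ θ s ρ' u' y' →
        ∀ a, (∀ t ∈ Icc 0 T, ρ' a t = ρ a t) ∧
          u' a =ᵐ[volume.restrict (Ioo 0 T)] u a ∧
          y' a =ᵐ[volume.restrict (Ioo 0 T)] y a := by
  obtain ⟨ρ, u, y, hsol, hu, hnonneg⟩ :=
    exists_isNetworkWeakSolution hN hT hp hb hd hlam hρ₀ hθ hs
  refine ⟨ρ, u, y, hsol, fun hρ₀0 hθ0 hs0 a => ?_, fun ρ' u' y' hsol' a => ?_⟩
  · obtain ⟨hρ0, huy0⟩ := hnonneg hρ₀0 hθ0 hs0 a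
    exact ⟨fun t _ => hρ0 t, huy0⟩
  · obtain ⟨hρ, huu', hyy'⟩ := hsol.unique hsol' hN hT hp hb hd hlam hρ₀ hu a
    exact ⟨hρ.symm, huu'.symm, hyy'.symm⟩

theorem mainTheorem1 (N : Network) (hN : N.Acyclic)
    (T : ℝ) (hT : 0 < T) (p : ℝ≥0∞) [Fact (1 ≤ p)] (hp : p ≠ ∞)
    (b d : ℝ) (hb : b ∈ Icc (0 : ℝ) 1) (hd : d ∈ Icc (0 : ℝ) 1)
    (lam : N.Link → ℝ → ℝ → ℝ) (hlam : ∀ a, IsVelocity T (lam a))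
    (ρ₀ : N.Link → ℝ → ℝ) (hρ₀ : ∀ a, IsLinftyNonneg (Ioo 0 1) (ρ₀ a))
    (θ : N.Link → ℝ → ℝ) (hθ : IsSplit N T θ)
    (s : N.Link → ℝ → ℝ) (hs : IsSource N T s) :
    ∃ (ρ : N.Link → ℝ → LpUnit p) (u y : N.Link → ℝ → ℝ),
      IsNetworkWeakSolution N T p b d lam ρ₀ θ s ρ u y ∧
      (∀ a, (∀ t ∈ Icc 0 T, ∀ᵐ x ∂volume.restrict (Ioo (0 : ℝ) 1), 0 ≤ ρ a t x) ∧
        (∀ᵐ t ∂volume.restrict (Ioo 0 T), 0 ≤ u a t) ∧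
        (∀ᵐ t ∂volume.restrict (Ioo 0 T), 0 ≤ y a t)) ∧
      ∀ (ρ' : N.Link → ℝ → LpUnit p) (u' y' : N.Link → ℝ → ℝ),
        IsNetworkWeakSolution N T p b d lam ρ₀ θ s ρ' u' y' →
        ∀ a, (∀ t ∈ Icc 0 T, ρ' a t = ρ a t) ∧
          u' a =ᵐ[volume.restrict (Ioo 0 T)] u a ∧
          y' a =ᵐ[volume.restrict (Ioo 0 T)] y a := by
  obtain ⟨ρ, u, y, hsol, hnonneg, hunique⟩ := mainTheorem1_general (p := p) hN hT hp hb hd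
    (fun a => (hlam a).isLipschitzVelocity) (fun a => (hρ₀ a).1) (fun a => (hθ.1 a).1)
    fun a => (hs a).1
  exact ⟨ρ, u, y, hsol, hnonneg (fun a => (hρ₀ a).2) (fun a => (hθ.1 a).2) fun a => (hs a).2,
    hunique⟩
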